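/- Let $n$ be a dimension. For real $n\times n$ matrices $P=P^T$, $Q=Q^T$ and $L$ with $\det L\neq 0$ put $W(x,x')=\frac12 Px\cdot x-Lx\cdot x'+\frac12 Qx'\cdot x'$, and let $$S_W=\begin{pmatrix}L^{-1}Q & L^{-1}\\ PL^{-1}Q-L^T & PL^{-1}\end{pmatrix}\in Sp(n,\mathbb{R}).$$ For every $m\in\mathbb{Z}$ with $m\pi\equiv\arg\det L \pmod{2\pi}$ let $\widehat S_{W,m}$ be the unitary operator of $L^2(\mathbb{R}^n)$ given on $\psi\in\mathcal S(\mathbb{R}^n)$ by $$\widehat S_{W,m}\psi(x)=\frac{i^m\sqrt{|\det L|}}{(2\pi)^{n/2}e^{i\pi n/4}}\int_{\mathbb{R}^n}e^{iW(x,x')}\psi(x')\,dx'.$$ The metaplectic group $Mp(n,\mathbb{R})$ is the group of unitary operators of $L^2(\mathbb{R}^n)$ generated by the operators $\widehat S_{W,m}$, and $\pi:Mp(n,\mathbb{R})\to Sp(n,\mathbb{R})$ is the group homomorphism with $\pi(\widehat S_{W,m})=S_W$. For $S\in Sp(n,\mathbb{R})$ let $\lambda_1(S)\geq\dots\geq\lambda_n(S)\geq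 1$ be its $n$ largest singular values, counted with multiplicity (its singular values are $\lambda_1\geq\dots\geq\lambda_n\geq\lambda_n^{-1}\geq\dots\geq\lambda_1^{-1}$). Fix a window $\varphi\in\mathcal S(\mathbb{R}^n)\setminus\{0\}$, let $\varphi_z(y)=e^{i\xi\cdot y}\varphi(y-x)$ for $z=(x,\xi)\in\mathbb{R}^n\times\mathbb{R}^n$, and put $$\|f\|_{M^1}=\int_{\mathbb{R}^{2n}}|\langle f,\varphi_z\rangle|\,dz,\qquad \|f\|_{M^\infty}=\operatorname*{ess\,sup}_{z\in\mathbb{R}^{2n}}|\langle f,\varphi_z\rangle|,$$ where $\langle f,g\rangle=\int_{\mathbb{R}^n} f\,\overline{g}$. **Theorem 1.1 (Dispersive estimate).** There is a constant $C>0$, depending only on $n$ and $\varphi$, such that for every $\widehat S\in Mp(n,\mathbb{R})$, with projection $S=\pi(\widehat S)$, and every $\psi\in\mathcal S(\mathbb{R}^n)$, $$\|\widehat S\psi\|_{M^\infty}\leq C\,\bigl(\lambda_1(S)\cdots\lambda_n(S)\bigr)^{-1/2}\,\|\psi\|_{M^1}.$$ -/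

import Mathlib

open MeasureTheory Matrix
open scoped SchwartzMap ENNReal ComplexConjugate

noncomputable section

namespace Metaplectic

/-- Euclidean space `ℝⁿ`, with its Lebesgue measure `volume`. -/
abbrev E (n : ℕ) : Type := EuclideanSpace ℝ (Fin n)

/-- The Hilbert space `L²(ℝⁿ)` of complex-valued functions. -/
abbrev L2 (n : ℕ) : Type := Lp ℂ 2 (volume : Measure (E n))

/-- The real symplectic group `Sp(n,ℝ)` of `2n × 2n` matrices (in `n × n` blocks). -/
abbrev Sp (n : ℕ) : Type := symplecticGroup (Fin n) ℝ

/-- The data of a quadratic form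
`W(x,x') = ½ Px·x - Lx·x' + ½ Qx'·x'` with `P = Pᵀ`, `Q = Qᵀ` and `det L ≠ 0`. -/
structure GeneratingFunction (n : ℕ) where
  P : Matrix (Fin n) (Fin n) ℝ
  L : Matrix (Fin n) (Fin n) ℝ
  Q : Matrix (Fin n) (Fin n) ℝ
  P_symm : Pᵀ = P
  Q_symm : Qᵀ = Q
  det_L_ne_zero : L.det ≠ 0

namespace GeneratingFunction

variable {n : ℕ}

/-- The value `W(x,x') = ½ Px·x - Lx·x' + ½ Qx'·x'`. -/
def eval (W : GeneratingFunction n) (x x' : E n) : ℝ :=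
  1 / 2 * ((W.P *ᵥ x.ofLp) ⬝ᵥ x.ofLp) - (W.L *ᵥ x.ofLp) ⬝ᵥ x'.ofLp
    + 1 / 2 * ((W.Q *ᵥ x'.ofLp) ⬝ᵥ x'.ofLp)

/-- The block matrix of the free symplectic matrix generated by `W`. -/
def freeMatrix (W : GeneratingFunction n) : Matrix (Fin n ⊕ Fin n) (Fin n ⊕ Fin n) ℝ :=
  fromBlocks (W.L⁻¹ * W.Q) W.L⁻¹ (W.P * W.L⁻¹ * W.Q - W.Lᵀ) (W.P * W.L⁻¹)

theorem freeMatrix_mem (W : GeneratingFunction n) :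
    W.freeMatrix ∈ symplecticGroup (Fin n) ℝ := by
  have hL : IsUnit W.L.det := isUnit_iff_ne_zero.mpr W.det_L_ne_zero
  have hLt : IsUnit (W.Lᵀ).det := by rwa [det_transpose]
  have h1 : W.L * W.L⁻¹ = 1 := mul_nonsing_inv _ hL
  have h2 : (W.Lᵀ)⁻¹ * W.Lᵀ = 1 := nonsing_inv_mul _ hLt
  rw [SymplecticGroup.mem_iff', freeMatrix, J, fromBlocks_transpose, fromBlocks_multiply,
    fromBlocks_multiply]
  simp only [transpose_sub, transpose_mul, transpose_transpose, transpose_nonsing_inv,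
    W.P_symm, W.Q_symm, Matrix.mul_zero, Matrix.mul_one, zero_add, add_zero, Matrix.mul_neg,
    Matrix.neg_mul, Matrix.sub_mul, Matrix.mul_sub, Matrix.mul_assoc, h1, h2]
  simp only [← Matrix.mul_assoc W.L, h1, Matrix.one_mul]
  congr 1 <;> abel

/-- The free symplectic matrix `S_W` generated by `W`. -/
def freeSymplectic (W : GeneratingFunction n) : Sp n := ⟨W.freeMatrix, W.freeMatrix_mem⟩

/-- `m` is an admissible Maslov index for `W`: `m π ≡ arg (det L)` modulo `2π`. -/
def IsMaslovIndex (W : GeneratingFunction n) (m : ℤ) : Prop :=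
  ∃ k : ℤ, (m : ℝ) * Real.pi = Complex.arg ((W.L.det : ℝ) : ℂ) + 2 * Real.pi * k

/-- The quadratic Fourier integral
`(2πi)^{-n/2} i^m √|det L| ∫ e^{i W(x,x')} ψ(x') dx'`, where
`(2πi)^{n/2} = (2π)^{n/2} e^{iπn/4}`. -/
def fourierIntegral (W : GeneratingFunction n) (m : ℤ) (ψ : 𝓢(E n, ℂ)) (x : E n) : ℂ :=
  1 / ((((2 * Real.pi) ^ ((n : ℝ) / 2) : ℝ) : ℂ) * Complex.exp (Complex.I * Real.pi * n / 4))
    * (Complex.I ^ m * (Real.sqrt |W.L.det| : ℂ))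
    * ∫ x' : E n, Complex.exp (Complex.I * (W.eval x x' : ℂ)) * ψ x'

/-- The unitary operator `U` of `L²(ℝⁿ)` is the quadratic Fourier transform `Ŝ_{W,m}`:
on Schwartz functions, which are dense in `L²`, it is given by the quadratic Fourier integral. -/
def IsQuadraticFourierTransform (W : GeneratingFunction n) (m : ℤ) (U : L2 n ≃ₗᵢ[ℂ] L2 n) :
    Prop :=
  W.IsMaslovIndex m ∧
    ∀ ψ : 𝓢(E n, ℂ), (U (ψ.toLp 2 volume) : E n → ℂ) =ᵐ[volume] W.fourierIntegral m ψ

end GeneratingFunction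

/-- The metaplectic group `Mp(n,ℝ)`: the subgroup of the unitary group of `L²(ℝⁿ)` generated by
the quadratic Fourier transforms. -/
def Mp (n : ℕ) : Subgroup (L2 n ≃ₗᵢ[ℂ] L2 n) :=
  Subgroup.closure {U | ∃ (W : GeneratingFunction n) (m : ℤ), W.IsQuadraticFourierTransform m U}

/-- The graph of the projection `π : Mp(n,ℝ) → Sp(n,ℝ)`, the group homomorphism that extends
`Ŝ_{W,m} ↦ S_W`: as a subgroup of the product it is generated by the pairs `(Ŝ_{W,m}, S_W)`. -/
def projectionGraph (n : ℕ) : Subgroup ((L2 n ≃ₗᵢ[ℂ] L2 n) × Sp n) :=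
  Subgroup.closure {p | ∃ (W : GeneratingFunction n) (m : ℤ),
    W.IsQuadraticFourierTransform m p.1 ∧ p.2 = W.freeSymplectic}

/-- `S = π(Ŝ)`. -/
def IsProjection {n : ℕ} (Shat : L2 n ≃ₗᵢ[ℂ] L2 n) (S : Sp n) : Prop :=
  (Shat, S) ∈ projectionGraph n

/-- The metaplectic operators are exactly the unitary operators that have a projection. -/
theorem mem_Mp_iff {n : ℕ} (Shat : L2 n ≃ₗᵢ[ℂ] L2 n) :
    Shat ∈ Mp n ↔ ∃ S : Sp n, IsProjection Shat S := by
  have h : (projectionGraph n).map (MonoidHom.fst (L2 n ≃ₗᵢ[ℂ] L2 n) (Sp n)) = Mp n := by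
    rw [projectionGraph, MonoidHom.map_closure, Mp]
    congr 1
    ext U
    constructor
    · rintro ⟨p, ⟨W, m, hW, -⟩, rfl⟩
      exact ⟨W, m, hW⟩
    · rintro ⟨W, m, hW⟩
      exact ⟨(U, W.freeSymplectic), ⟨W, m, hW, rfl⟩, rfl⟩
  rw [← h]
  constructor
  · rintro ⟨⟨U, S⟩, hp, rfl⟩
    exact ⟨S, hp⟩
  · rintro ⟨S, hS⟩
    exact ⟨(Shat, S), hS, rfl⟩

/-- The singular values of `S`, with multiplicity, in decreasing order, indexed from `0`. For
symplectic `S` they are `λ₁ ≥ … ≥ λₙ ≥ λₙ⁻¹ ≥ … ≥ λ₁⁻¹`, so that `λ₁, …, λₙ` (the singular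
values `≥ 1`) are those with index `< n`. -/
def singularValue {n : ℕ} (S : Sp n) (i : ℕ) : ℝ :=
  (Matrix.toEuclideanLin (S : Matrix (Fin n ⊕ Fin n) (Fin n ⊕ Fin n) ℝ)).singularValues i

/-- The time-frequency shift `φ_z(y) = e^{iξ·y} φ(y - x)`, for `z = (x,ξ)`. -/
def timeFrequencyShift {n : ℕ} (φ : E n → ℂ) (z : E n × E n) (y : E n) : ℂ :=
  Complex.exp (Complex.I * ((inner ℝ z.2 y : ℝ) : ℂ)) * φ (y - z.1)

/-- The modulation space norm `‖f‖_{M^p} = ‖z ↦ ⟨f, φ_z⟩‖_{L^p(ℝ²ⁿ)}` with window `φ`, for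
functions `f` whose products with Schwartz functions are integrable (such as `f ∈ L²`); the
pairing is linear in `f`. The value is in `[0,∞]`. -/
def modulationNorm {n : ℕ} (φ : 𝓢(E n, ℂ)) (p : ℝ≥0∞) (f : E n → ℂ) : ℝ≥0∞ :=
  eLpNorm (fun z : E n × E n => ∫ y : E n, f y * conj (timeFrequencyShift φ z y)) p volume

end Metaplectic

end

/-! Everything is reduced to Gaussians `exp (-½ x·Mx + b·x)`, where `M` is complex symmetric with
positive definite real part and `b` is a complex vector. A quadratic Fourier transform sends such a
Gaussian to a multiple of another one, and the Lagrangian plane `{(x, iMx)}` moves by `S_W`. Hence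
every metaplectic `U` over `S` does the same, with `S` acting on the plane
(`IsProjection.transformsGaussians`). The scalar factors are never computed: unitarity of `U` fixes
their modulus.

Let `M` be the image of the identity matrix under `S`. Two facts meet. Explicit Gaussian integrals
bound the fourth power of the normalized pairing with a standard Gaussian by `4 ^ n * det (Re M) /
|det (M + 1)| ^ 2` (`norm_inner_gaussian_pow_four_le`). Symplectic algebra shows that `det (Re M) /
|det (M + 1)| ^ 2` is exactly `1 / det (1 + SᵀS)` (`SiegelRel.det_rePart_mul`). Since `det (1 + SᵀS)
= ∏ (1 + σᵢ²) ≥ (λ₁⋯λₙ)²`, a fourth root gives the factor `(λ₁⋯λₙ)^(-1/2)` for all Gaussian wave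
packets at once.

The passage to arbitrary `ψ` and `φ` uses one inequality twice (`enorm_integral_mul_conj_le`): by
the resolution of the identity, `(2π)^n |⟨f,k⟩| |⟨γ,φ⟩|` is at most the supremum of `|⟨k,γ_z⟩|`
times the `M¹` norm of `f` with window `φ`. Applied to `f = φ` with Gaussian windows it replaces the
Gaussian analysis window by `φ` (`exists_norm_stft_le`); this needs Schwartz functions to lie in
`M¹`. Applied to `f = ψ` and `k = U⁻¹ φ_w`, with a Gaussian `γ` not orthogonal to `φ`, it gives the
theorem. -/

noncomputable section

namespace Metaplectic

/-! ### Complexification of real matrices and vectors -/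

/-- The complexification of a real matrix. -/
def toC {m n : Type*} (K : Matrix m n ℝ) : Matrix m n ℂ := K.map Complex.ofReal

/-- The complexification of a real vector. -/
def vecC {n : Type*} (v : n → ℝ) : n → ℂ := fun i => (v i : ℂ)

section Complexification

variable {l m n : Type*}

@[simp] theorem toC_apply (K : Matrix m n ℝ) (i : m) (j : n) : toC K i j = (K i j : ℂ) := rfl

@[simp] theorem vecC_apply (v : n → ℝ) (i : n) : vecC v i = (v i : ℂ) := rfl

theorem toC_mul [Fintype m] (A : Matrix l m ℝ) (B : Matrix m n ℝ) :
    toC (A * B) = toC A * toC B := by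
  ext i j; simp [Matrix.mul_apply]

theorem toC_transpose (A : Matrix m n ℝ) : toC Aᵀ = (toC A)ᵀ := rfl

theorem toC_conjTranspose (A : Matrix m n ℝ) : (toC A)ᴴ = (toC A)ᵀ := by
  ext i j; simp

@[simp] theorem toC_one [DecidableEq n] : toC (1 : Matrix n n ℝ) = 1 := by
  ext i j; by_cases h : i = j <;> simp [Matrix.one_apply, h]

theorem toC_add (A B : Matrix m n ℝ) : toC (A + B) = toC A + toC B := by
  ext i j; simp

theorem toC_sub (A B : Matrix m n ℝ) : toC (A - B) = toC A - toC B := by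
  ext i j; simp

theorem toC_neg (A : Matrix m n ℝ) : toC (-A) = -toC A := by
  ext i j; simp

theorem toC_mulVec [Fintype n] (A : Matrix m n ℝ) (v : n → ℝ) :
    toC A *ᵥ vecC v = vecC (A *ᵥ v) := by
  ext i; simp [mulVec, dotProduct]

theorem vecC_dotProduct [Fintype n] (v w : n → ℝ) :
    vecC v ⬝ᵥ vecC w = ((v ⬝ᵥ w : ℝ) : ℂ) := by
  simp [dotProduct]

@[simp] theorem star_vecC (v : n → ℝ) : star (vecC v) = vecC v := by
  ext i; simp

theorem det_toC [Fintype n] [DecidableEq n] (A : Matrix n n ℝ) : (toC A).det = (A.det : ℂ) := by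
  have h := (Complex.ofRealHom.map_det A).symm
  exact h

theorem toC_inv [Fintype n] [DecidableEq n] {A : Matrix n n ℝ} (hA : A.det ≠ 0) :
    toC A⁻¹ = (toC A)⁻¹ := by
  refine (Matrix.inv_eq_left_inv ?_).symm
  rw [← toC_mul, Matrix.nonsing_inv_mul _ (isUnit_iff_ne_zero.mpr hA), toC_one]

theorem isUnit_det_toC [Fintype n] [DecidableEq n] {A : Matrix n n ℝ} (hA : A.det ≠ 0) :
    IsUnit (toC A).det := by
  rw [det_toC, isUnit_iff_ne_zero]; exact_mod_cast hA

theorem toC_fromBlocks {o : Type*} (A : Matrix n l ℝ) (B : Matrix n m ℝ) (C : Matrix o l ℝ)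
    (D : Matrix o m ℝ) :
    toC (fromBlocks A B C D) = fromBlocks (toC A) (toC B) (toC C) (toC D) := by
  ext (i | i) (j | j) <;> rfl

end Complexification

/-! ### The Siegel half-space -/

/-- Complex symmetric matrices with positive definite real part. -/
def IsSiegel {n : ℕ} (M : Matrix (Fin n) (Fin n) ℂ) : Prop :=
  Mᵀ = M ∧ ∀ y : Fin n → ℂ, y ≠ 0 → 0 < (star y ⬝ᵥ M *ᵥ y).re

namespace IsSiegel

variable {n : ℕ} {M : Matrix (Fin n) (Fin n) ℂ}

theorem isUnit_det (h : IsSiegel M) : IsUnit M.det := by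
  rw [isUnit_iff_ne_zero]
  intro h0
  obtain ⟨v, hv, hMv⟩ := Matrix.exists_mulVec_eq_zero_iff.mpr h0
  have := h.2 v hv
  simp [hMv] at this

theorem one : IsSiegel (1 : Matrix (Fin n) (Fin n) ℂ) := by
  refine ⟨by simp, fun y hy => ?_⟩
  rw [one_mulVec]
  obtain ⟨i, hi⟩ := Function.ne_iff.mp hy
  have h : (star y ⬝ᵥ y).re = ∑ i, Complex.normSq (y i) := by
    simp [dotProduct, Complex.normSq_apply]
  rw [h]
  exact Finset.sum_pos' (fun i _ => Complex.normSq_nonneg _)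
    ⟨i, Finset.mem_univ i, Complex.normSq_pos.mpr hi⟩

theorem add {N : Matrix (Fin n) (Fin n) ℂ} (h : IsSiegel M) (h' : IsSiegel N) :
    IsSiegel (M + N) := by
  refine ⟨by rw [transpose_add, h.1, h'.1], fun y hy => ?_⟩
  rw [add_mulVec, dotProduct_add, Complex.add_re]
  exact _root_.add_pos (h.2 y hy) (h'.2 y hy)

theorem inv (h : IsSiegel M) : IsSiegel M⁻¹ := by
  refine ⟨by rw [transpose_nonsing_inv, h.1], fun v hv => ?_⟩
  have hv' : M *ᵥ (M⁻¹ *ᵥ v) = v := by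
    rw [mulVec_mulVec, mul_nonsing_inv _ h.isUnit_det, one_mulVec]
  have hy : M⁻¹ *ᵥ v ≠ 0 := by
    intro h0; rw [h0, mulVec_zero] at hv'; exact hv hv'.symm
  have := h.2 _ hy
  rw [hv', star_dotProduct] at this
  simpa using this

theorem congr (h : IsSiegel M) {K : Matrix (Fin n) (Fin n) ℝ} (hK : K.det ≠ 0) :
    IsSiegel ((toC K)ᵀ * M * toC K) := by
  refine ⟨by simp [transpose_mul, h.1, Matrix.mul_assoc], fun y hy => ?_⟩
  have hy' : toC K *ᵥ y ≠ 0 := by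
    intro h0
    apply hy
    have : (toC K)⁻¹ *ᵥ (toC K *ᵥ y) = y := by
      rw [mulVec_mulVec, nonsing_inv_mul _ (isUnit_det_toC hK), one_mulVec]
    rw [← this, h0, mulVec_zero]
  have := h.2 _ hy'
  rwa [star_mulVec, toC_conjTranspose, ← dotProduct_mulVec, mulVec_mulVec, mulVec_mulVec] at this

theorem add_I_smul (h : IsSiegel M) {P : Matrix (Fin n) (Fin n) ℝ} (hP : Pᵀ = P) :
    IsSiegel (M + Complex.I • toC P) := by
  refine ⟨by rw [transpose_add, transpose_smul, h.1, ← toC_transpose, hP], fun y hy => ?_⟩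
  have h0 : (star y ⬝ᵥ toC P *ᵥ y).im = 0 := by
    rw [← Complex.conj_eq_iff_im]
    conv_rhs => rw [star_dotProduct, star_mulVec, toC_conjTranspose, ← toC_transpose, hP,
      ← dotProduct_mulVec]
    rfl
  rw [add_mulVec, smul_mulVec, dotProduct_add, dotProduct_smul, Complex.add_re]
  have := h.2 y hy
  simpa [h0] using this

theorem sub_I_smul (h : IsSiegel M) {P : Matrix (Fin n) (Fin n) ℝ} (hP : Pᵀ = P) :
    IsSiegel (M - Complex.I • toC P) := by
  have := h.add_I_smul (P := -P) (by rw [transpose_neg, hP])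
  rwa [toC_neg, smul_neg, ← sub_eq_add_neg] at this

end IsSiegel

/-! ### Diagonalization by congruence and inequalities for quadratic forms. -/

/-- The real part of a complex matrix. -/
def rePart {n : ℕ} (M : Matrix (Fin n) (Fin n) ℂ) : Matrix (Fin n) (Fin n) ℝ := M.map Complex.re

/-- The imaginary part of a complex matrix. -/
def imPart {n : ℕ} (M : Matrix (Fin n) (Fin n) ℂ) : Matrix (Fin n) (Fin n) ℝ := M.map Complex.im

theorem rePart_add_imPart {n : ℕ} (M : Matrix (Fin n) (Fin n) ℂ) :
    toC (rePart M) + Complex.I • toC (imPart M) = M := by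
  ext i j
  simp [rePart, imPart, mul_comm Complex.I, Complex.re_add_im]

theorem re_vecC_dotProduct {n : ℕ} (v : Fin n → ℝ) (w : Fin n → ℂ) :
    (vecC v ⬝ᵥ w).re = v ⬝ᵥ fun i => (w i).re := by
  simp [dotProduct]

theorem re_mulVec_vecC {n : ℕ} (M : Matrix (Fin n) (Fin n) ℂ) (v : Fin n → ℝ) :
    (vecC v ⬝ᵥ M *ᵥ vecC v).re = v ⬝ᵥ rePart M *ᵥ v := by
  rw [re_vecC_dotProduct]
  congr 1
  ext i
  simp [mulVec, dotProduct, rePart]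

theorem IsSiegel.posDef_rePart {n : ℕ} {M : Matrix (Fin n) (Fin n) ℂ} (h : IsSiegel M) :
    (rePart M).PosDef := by
  refine Matrix.PosDef.of_dotProduct_mulVec_pos ?_ fun v hv => ?_
  · ext i j
    have := congrFun (congrFun h.1 i) j
    simp only [transpose_apply] at this
    simp [rePart, this]
  · have hv' : vecC v ≠ 0 := by
      intro h0; apply hv; ext i; simpa using congrFun h0 i
    have := h.2 _ hv'
    rw [star_vecC, re_mulVec_vecC] at this
    simpa using this

/-- A real symmetric matrix is diagonalized by an orthogonal congruence. -/
theorem exists_orthogonal_diagonal {n : ℕ} {A : Matrix (Fin n) (Fin n) ℝ} (hA : A.IsHermitian) :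
    ∃ O : Matrix (Fin n) (Fin n) ℝ, Oᵀ * O = 1 ∧ A = Oᵀ * diagonal hA.eigenvalues * O := by
  refine ⟨(hA.eigenvectorUnitary : Matrix (Fin n) (Fin n) ℝ)ᵀ, ?_, ?_⟩
  · have := Unitary.coe_mul_star_self hA.eigenvectorUnitary
    simpa [star_eq_conjTranspose, conjTranspose_eq_transpose_of_trivial] using this
  · conv_lhs => rw [hA.spectral_theorem]
    rw [Unitary.conjStarAlgAut_apply]
    simp only [star_eq_conjTranspose, conjTranspose_eq_transpose_of_trivial, transpose_transpose]
    rfl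

/-- A positive definite and a symmetric real matrix are simultaneously diagonalized by a
congruence. -/
theorem exists_simultaneous_diagonal {n : ℕ} {R T : Matrix (Fin n) (Fin n) ℝ} (hR : R.PosDef)
    (hT : Tᵀ = T) : ∃ (K : Matrix (Fin n) (Fin n) ℝ) (d : Fin n → ℝ), K.det ≠ 0 ∧
      R = Kᵀ * K ∧ T = Kᵀ * diagonal d * K := by
  obtain ⟨O, hO, hRO⟩ := exists_orthogonal_diagonal hR.isHermitian
  set μ := hR.isHermitian.eigenvalues
  have hμ : ∀ i, 0 < μ i := hR.eigenvalues_pos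
  set K₁ := diagonal (fun i => √(μ i)) * O with hK₁
  have hRK : R = K₁ᵀ * K₁ := by
    rw [hK₁, transpose_mul, diagonal_transpose, hRO]
    simp only [Matrix.mul_assoc]
    rw [← Matrix.mul_assoc (diagonal _) (diagonal _) O, diagonal_mul_diagonal]
    congr 3
    ext i; exact (Real.mul_self_sqrt (hμ i).le).symm
  have hdK : IsUnit K₁.det := by
    rw [isUnit_iff_ne_zero]
    intro h0
    have := hR.det_pos
    rw [hRK, det_mul, h0, mul_zero] at this
    exact this.false
  have hdK' : IsUnit K₁ᵀ.det := by rwa [det_transpose]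
  -- After `K₁` has normalized `R` to the identity, an orthogonal change of basis diagonalizes `T`
  -- without disturbing that normalization.
  have hS : (K₁ᵀ⁻¹ * T * K₁⁻¹).IsHermitian := by
    rw [IsHermitian, conjTranspose_eq_transpose_of_trivial, transpose_mul, transpose_mul, hT,
      transpose_nonsing_inv, transpose_nonsing_inv, transpose_transpose, Matrix.mul_assoc]
  obtain ⟨V, hV, hTV⟩ := exists_orthogonal_diagonal hS
  refine ⟨V * K₁, hS.eigenvalues, ?_, ?_, ?_⟩
  · rw [det_mul]
    refine mul_ne_zero (fun h0 => ?_) hdK.ne_zero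
    have := congrArg det hV
    rw [det_mul, h0, mul_zero, det_one] at this
    exact zero_ne_one this
  · rw [transpose_mul, Matrix.mul_assoc, ← Matrix.mul_assoc Vᵀ, hV, Matrix.one_mul, hRK]
  · have : T = K₁ᵀ * (K₁ᵀ⁻¹ * T * K₁⁻¹) * K₁ := by
      simp only [Matrix.mul_assoc]
      rw [nonsing_inv_mul _ hdK, Matrix.mul_one, ← Matrix.mul_assoc, mul_nonsing_inv _ hdK',
        Matrix.one_mul]
    conv_lhs => rw [this, hTV]
    simp only [transpose_mul, Matrix.mul_assoc]

theorem IsSiegel.exists_diagonal {n : ℕ} {M : Matrix (Fin n) (Fin n) ℂ} (h : IsSiegel M) :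
    ∃ (K : Matrix (Fin n) (Fin n) ℝ) (d : Fin n → ℝ), K.det ≠ 0 ∧
      M = (toC K)ᵀ * diagonal (fun i => 1 + Complex.I * (d i : ℂ)) * toC K := by
  have hT : (imPart M)ᵀ = imPart M := by
    ext i j
    have := congrFun (congrFun h.1 i) j
    simp only [transpose_apply] at this
    simp [imPart, this]
  obtain ⟨K, d, hK, hR, hT⟩ := exists_simultaneous_diagonal h.posDef_rePart hT
  refine ⟨K, d, hK, ?_⟩
  rw [← rePart_add_imPart M, hR, hT]
  have hd : diagonal (fun i => 1 + Complex.I * (d i : ℂ))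
      = 1 + Complex.I • toC (diagonal d) := by
    ext i j
    by_cases hij : i = j <;> simp [hij]
  rw [hd, Matrix.mul_add, Matrix.add_mul, toC_mul, toC_mul, toC_mul, toC_transpose]
  simp

/-- The cross terms cancel by symmetry of `M`, and only the real part of `M` acts on real vectors.
-/
theorem re_star_dotProduct_mulVec {n : ℕ} {M : Matrix (Fin n) (Fin n) ℂ} (hM : Mᵀ = M)
    (p q : Fin n → ℝ) :
    (star (vecC p + Complex.I • vecC q) ⬝ᵥ M *ᵥ (vecC p + Complex.I • vecC q)).re
      = p ⬝ᵥ rePart M *ᵥ p + q ⬝ᵥ rePart M *ᵥ q := by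
  have hsymm : vecC q ⬝ᵥ M *ᵥ vecC p = vecC p ⬝ᵥ M *ᵥ vecC q := by
    rw [dotProduct_mulVec, ← mulVec_transpose, hM, dotProduct_comm]
  have h : star (vecC p + Complex.I • vecC q) ⬝ᵥ M *ᵥ (vecC p + Complex.I • vecC q)
      = vecC p ⬝ᵥ M *ᵥ vecC p + vecC q ⬝ᵥ M *ᵥ vecC q := by
    simp only [star_add, star_smul, star_vecC, mulVec_add, mulVec_smul, add_dotProduct,
      dotProduct_add, smul_dotProduct, dotProduct_smul, hsymm, smul_eq_mul]
    have hI : star Complex.I = -Complex.I := Complex.conj_I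
    rw [hI]
    linear_combination (-(vecC q ⬝ᵥ M *ᵥ vecC q)) * Complex.I_mul_I
  rw [h, Complex.add_re, re_mulVec_vecC, re_mulVec_vecC]

/-- Completing the square: the difference of the two sides is the form `R` evaluated at `p - R⁻¹β`.
-/
theorem two_mul_dotProduct_sub_le {n : ℕ} {R : Matrix (Fin n) (Fin n) ℝ} (hR : R.PosDef)
    (p β : Fin n → ℝ) : 2 * (p ⬝ᵥ β) - p ⬝ᵥ R *ᵥ p ≤ β ⬝ᵥ R⁻¹ *ᵥ β := by
  have hu : IsUnit R.det := isUnit_iff_ne_zero.mpr hR.det_pos.ne'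
  have hRt : Rᵀ = R := by
    have := hR.isHermitian
    rwa [IsHermitian, conjTranspose_eq_transpose_of_trivial] at this
  have h := hR.posSemidef.dotProduct_mulVec_nonneg (p - R⁻¹ *ᵥ β)
  have h1 : R *ᵥ (R⁻¹ *ᵥ β) = β := by rw [mulVec_mulVec, mul_nonsing_inv _ hu, one_mulVec]
  have h2 : (R⁻¹ *ᵥ β) ⬝ᵥ R *ᵥ p = p ⬝ᵥ β := by
    rw [dotProduct_mulVec, ← mulVec_transpose, hRt, h1, dotProduct_comm]
  simp only [star_trivial, mulVec_sub, h1, sub_dotProduct, dotProduct_sub, h2] at h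
  rw [dotProduct_comm (R⁻¹ *ᵥ β) β] at h
  linarith

/-- The exponent of the pairing of two Gaussians is dominated by the exponents of their norms. -/
theorem IsSiegel.re_dotProduct_inv_le {n : ℕ} {M : Matrix (Fin n) (Fin n) ℂ} (h : IsSiegel M)
    (b d : Fin n → ℂ) :
    ((b + d) ⬝ᵥ (M + 1)⁻¹ *ᵥ (b + d)).re ≤
      (fun i => (b i).re) ⬝ᵥ (rePart M)⁻¹ *ᵥ (fun i => (b i).re)
        + (fun i => (d i).re) ⬝ᵥ (fun i => (d i).re) := by
  have hN : IsSiegel (M + 1) := h.add .one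
  set w := b + d
  set y := (M + 1)⁻¹ *ᵥ w with hy
  have hw : (M + 1) *ᵥ y = w := by
    rw [hy, mulVec_mulVec, mul_nonsing_inv _ hN.isUnit_det, one_mulVec]
  set p : Fin n → ℝ := fun i => (y i).re
  set q : Fin n → ℝ := fun i => (y i).im
  have hpq : y = vecC p + Complex.I • vecC q := by
    ext i; simp [p, q, mul_comm Complex.I, Complex.re_add_im]
  -- With `y = p + iq` this writes `y·w` as `2 p·w - y*·w`. Its real part is `(2 p·Re b - p·Rp) + (2
  -- p·Re d - p·p)` minus the nonnegative term `q·(R + 1)q`, and each bracket is bounded by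
  -- completing the square.
  have h1 : star y ⬝ᵥ w + y ⬝ᵥ w = 2 * (vecC p ⬝ᵥ w) := by
    have : star y + y = (2 : ℂ) • vecC p := by
      ext i
      simp only [p, Pi.add_apply, Pi.star_apply, Pi.smul_apply, vecC_apply, smul_eq_mul]
      rw [add_comm]; exact Complex.add_conj (y i) |>.trans (by push_cast; rfl)
    rw [← add_dotProduct, this, smul_dotProduct, smul_eq_mul]
  have h2 : (star y ⬝ᵥ w).re = p ⬝ᵥ rePart (M + 1) *ᵥ p + q ⬝ᵥ rePart (M + 1) *ᵥ q := by
    rw [← hw, hpq]; exact re_star_dotProduct_mulVec hN.1 p q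
  have h3 : rePart (M + 1) = rePart M + 1 := by
    ext i j; by_cases hij : i = j <;> simp [rePart, hij]
  have h4 : 0 ≤ q ⬝ᵥ rePart (M + 1) *ᵥ q := by
    simpa using hN.posDef_rePart.posSemidef.dotProduct_mulVec_nonneg q
  have h5 : (vecC p ⬝ᵥ w).re = p ⬝ᵥ (fun i => (b i).re) + p ⬝ᵥ (fun i => (d i).re) := by
    rw [re_vecC_dotProduct, ← dotProduct_add]; rfl
  have h6 := two_mul_dotProduct_sub_le h.posDef_rePart p (fun i => (b i).re)
  have h7 := two_mul_dotProduct_sub_le Matrix.PosDef.one p (fun i => (d i).re)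
  rw [inv_one, one_mulVec, one_mulVec] at h7
  rw [h3] at h2 h4
  rw [add_mulVec, one_mulVec, dotProduct_add p] at h2
  have h8 := congrArg Complex.re h1
  rw [Complex.add_re, Complex.mul_re, h5, h2] at h8
  simp only [Complex.re_ofNat, Complex.im_ofNat, zero_mul, sub_zero] at h8
  rw [dotProduct_comm w y]
  linarith

/-! ### The action of the symplectic group on the Siegel half-space -/

/-- The frame of the Lagrangian plane `{(x, iMx)}`. -/
def lagrangianFrame {n : ℕ} (M : Matrix (Fin n) (Fin n) ℂ) : Matrix (Fin n ⊕ Fin n) (Fin n) ℂ :=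
  fromRows 1 (Complex.I • M)

/-- `S` maps the Lagrangian plane `{(x, iMx)}` to `{(x, iM'x)}`. -/
def SiegelRel {n : ℕ} (S : Matrix (Fin n ⊕ Fin n) (Fin n ⊕ Fin n) ℝ)
    (M M' : Matrix (Fin n) (Fin n) ℂ) : Prop :=
  ∃ X : Matrix (Fin n) (Fin n) ℂ,
    toC S * lagrangianFrame M = lagrangianFrame M' * X

namespace SiegelRel

variable {n : ℕ} {S S' : Matrix (Fin n ⊕ Fin n) (Fin n ⊕ Fin n) ℝ}
  {M M' M'' : Matrix (Fin n) (Fin n) ℂ}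

theorem refl (M : Matrix (Fin n) (Fin n) ℂ) : SiegelRel 1 M M := ⟨1, by simp⟩

theorem trans (h : SiegelRel S M M') (h' : SiegelRel S' M' M'') : SiegelRel (S' * S) M M'' := by
  obtain ⟨X, hX⟩ := h
  obtain ⟨Y, hY⟩ := h'
  refine ⟨Y * X, ?_⟩
  rw [toC_mul, Matrix.mul_assoc, hX, ← Matrix.mul_assoc, hY, Matrix.mul_assoc]

end SiegelRel

/-- The block matrix represents multiplication by a complex structure-preserving map; conjugation by
`A`, whose columns span the eigenspaces `±i` of that structure, makes it block diagonal. -/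
theorem det_fromBlocks_neg {n : ℕ} (U V : Matrix (Fin n) (Fin n) ℂ) :
    (fromBlocks U V (-V) U).det = (U + Complex.I • V).det * (U - Complex.I • V).det := by
  set A : Matrix (Fin n ⊕ Fin n) (Fin n ⊕ Fin n) ℂ :=
    fromBlocks 1 1 (Complex.I • 1) (-(Complex.I • 1)) with hA
  have hAB : A * fromBlocks ((1 / 2 : ℂ) • 1) (-(Complex.I / 2) • 1) ((1 / 2 : ℂ) • 1)
      ((Complex.I / 2) • 1) = 1 := by
    rw [hA, fromBlocks_multiply, ← fromBlocks_one]
    congr 1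
    · simp only [one_mul, ← add_smul]; norm_num
    · simp only [one_mul, ← add_smul]; norm_num
    · simp
    · simp only [smul_mul_smul_comm, mul_one, neg_mul, ← neg_smul, ← add_smul]
      rw [show Complex.I * -(Complex.I / 2) + -(Complex.I * (Complex.I / 2)) = 1 by
        linear_combination (-1 : ℂ) * Complex.I_mul_I, one_smul]
  have hdet : A.det ≠ 0 := by
    intro h0
    have := congrArg det hAB
    rw [det_mul, h0, zero_mul, det_one] at this
    exact zero_ne_one this
  have hmul : fromBlocks U V (-V) U * A
      = A * fromBlocks (U + Complex.I • V) 0 0 (U - Complex.I • V) := by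
    rw [hA, fromBlocks_multiply, fromBlocks_multiply]
    congr 1
    · simp
    · simp [sub_eq_add_neg]
    · simp only [mul_one, mul_zero, add_zero, smul_mul, one_mul, smul_add, smul_smul,
        Complex.I_mul_I, Matrix.mul_smul, Matrix.smul_mul]
      rw [neg_smul, one_smul, add_comm]
    · simp only [mul_one, mul_zero, zero_add, mul_neg, neg_mul, one_mul, smul_sub, smul_smul,
        Complex.I_mul_I, Matrix.mul_smul, Matrix.smul_mul]
      rw [neg_smul, one_smul]; abel
  have := congrArg det hmul
  rw [det_mul, det_mul, det_fromBlocks_zero₂₁, mul_comm] at this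
  exact mul_left_cancel₀ hdet this

theorem normSq_det {n : ℕ} (U V : Matrix (Fin n) (Fin n) ℝ) :
    Complex.normSq (toC U + Complex.I • toC V).det = (fromBlocks U V (-V) U).det := by
  have h1 : toC U - Complex.I • toC V = (toC U + Complex.I • toC V).map (starRingEnd ℂ) := by
    ext i j; simp [sub_eq_add_neg]
  have h2 : ((toC U + Complex.I • toC V).map (starRingEnd ℂ)).det
      = starRingEnd ℂ (toC U + Complex.I • toC V).det := (RingHom.map_det _ _).symm
  have := det_fromBlocks_neg (toC U) (toC V)
  rw [h1, h2, ← toC_neg, ← toC_fromBlocks, det_toC, Complex.mul_conj] at this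
  exact_mod_cast this.symm

/-- The determinant of the complex linear part of a symplectic matrix. -/
theorem normSq_det_linear_part {n : ℕ} {A B C D : Matrix (Fin n) (Fin n) ℝ}
    (hS : fromBlocks A B C D ∈ symplecticGroup (Fin n) ℝ) :
    Complex.normSq (toC (A + D) + Complex.I • toC (B - C)).det
      = (1 + (fromBlocks A B C D)ᵀ * fromBlocks A B C D).det := by
  set S := fromBlocks A B C D with hSdef
  have hJ : Sᵀ * J (Fin n) ℝ * S = J (Fin n) ℝ := SymplecticGroup.mem_iff'.mp hS
  have hT : fromBlocks (A + D) (B - C) (-(B - C)) (A + D)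
      = S - J (Fin n) ℝ * S * J (Fin n) ℝ := by
    rw [hSdef, J, fromBlocks_multiply, fromBlocks_multiply, sub_eq_add_neg (fromBlocks A B C D),
      fromBlocks_neg, fromBlocks_add]
    congr 1 <;> simp [sub_eq_add_neg, add_comm]
  -- `SᵀJS = J` turns `SᵀJSJ` into `J² = -1`. As `det S = 1`, the factor `Sᵀ` does not change the
  -- determinant.
  have hST : Sᵀ * (S - J (Fin n) ℝ * S * J (Fin n) ℝ) = 1 + Sᵀ * S := by
    rw [Matrix.mul_sub, ← Matrix.mul_assoc, ← Matrix.mul_assoc, hJ, J_squared, sub_neg_eq_add,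
      add_comm]
  rw [normSq_det, hT, ← hST, det_mul, det_transpose, SymplecticGroup.det_eq_one hS, one_mul]

/-- For `S` with blocks `A, B, C, D` the relation reads `X = A + iB` and `MX = D - iC`. The
symplectic block identities give `X* (Re M) X = 1`, so `|det X|² det (Re M) = 1`. Moreover `(M + 1)X
= (A + D) + i(B - C)`, whose determinant has squared modulus `det (1 + SᵀS)`. -/
theorem SiegelRel.det_rePart_mul {n : ℕ} {S : Sp n} {M : Matrix (Fin n) (Fin n) ℂ}
    (hM : IsSiegel M)
    (h : SiegelRel (S : Matrix (Fin n ⊕ Fin n) (Fin n ⊕ Fin n) ℝ) 1 M) :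
    (rePart M).det *
      (1 + (S : Matrix (Fin n ⊕ Fin n) (Fin n ⊕ Fin n) ℝ)ᵀ * S.1).det
      = ‖(M + 1).det‖ ^ 2 := by
  obtain ⟨X, hX⟩ := h
  obtain ⟨S, hS⟩ := S
  obtain ⟨A, B, C, D, rfl⟩ : ∃ A B C D, S = fromBlocks A B C D :=
    ⟨_, _, _, _, (fromBlocks_toBlocks S).symm⟩
  rw [toC_fromBlocks, lagrangianFrame, lagrangianFrame, fromBlocks_mul_fromRows,
    fromRows_mul] at hX
  obtain ⟨hX1, hX2⟩ := fromRows_inj hX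
  have hXe : X = toC A + Complex.I • toC B := by simpa using hX1.symm
  have hYe : M * X = toC D - Complex.I • toC C := by
    have : M * X = -Complex.I • (Complex.I • M * X) := by
      rw [Matrix.smul_mul, smul_smul, neg_mul, Complex.I_mul_I, neg_neg, one_smul]
    rw [this, ← hX2]
    simp only [Matrix.mul_one, Matrix.mul_smul, smul_add, smul_smul, neg_mul, Complex.I_mul_I,
      neg_neg, one_smul, neg_smul]
    abel
  obtain ⟨h1, h2, h3⟩ := SymplecticGroup.fromBlocks_mem_iff.mp hS
  have h4 : Dᵀ * A - Bᵀ * C = 1 := by simpa using congrArg transpose h3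
  have h1c := congrArg toC h1
  have h2c := congrArg toC h2
  have h3c := congrArg toC h3
  have h4c := congrArg toC h4
  simp only [toC_mul, toC_sub, toC_one, toC_transpose] at h1c h2c h3c h4c
  have hsum : Xᴴ * (M * X) + (M * X)ᴴ * X = (2 : ℂ) • 1 := by
    rw [hYe, hXe]
    simp only [conjTranspose_add, conjTranspose_sub, conjTranspose_smul, toC_conjTranspose,
      Matrix.add_mul, Matrix.sub_mul, Matrix.mul_add, Matrix.mul_sub, Matrix.smul_mul,
      Matrix.mul_smul, smul_smul, smul_add, smul_sub]
    have hI : star Complex.I = -Complex.I := Complex.conj_I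
    rw [hI, h1c, h2c, eq_add_of_sub_eq h3c, eq_add_of_sub_eq h4c, two_smul]
    simp only [mul_neg, Complex.I_mul_I, neg_smul, neg_neg, one_smul]
    abel
  have hR : M + Mᴴ = (2 : ℂ) • toC (rePart M) := by
    ext i j
    have := congrFun (congrFun hM.1 i) j
    rw [transpose_apply] at this
    simp only [Matrix.add_apply, conjTranspose_apply, this, Matrix.smul_apply, toC_apply, rePart,
      map_apply, smul_eq_mul]
    exact (Complex.add_conj _).trans (by push_cast; rfl)
  have hXR : Xᴴ * toC (rePart M) * X = 1 := by
    have : (2 : ℂ) • (Xᴴ * toC (rePart M) * X) = (2 : ℂ) • 1 := by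
      rw [← hsum, ← Matrix.smul_mul, ← Matrix.mul_smul, ← hR, conjTranspose_mul]
      simp only [Matrix.mul_add, Matrix.add_mul, Matrix.mul_assoc]
    exact smul_right_injective _ two_ne_zero this
  have hd1 : Complex.normSq X.det * (rePart M).det = 1 := by
    have := congrArg det hXR
    rw [det_mul, det_mul, det_conjTranspose, det_toC, det_one, mul_right_comm] at this
    have h' : star X.det * X.det = (Complex.normSq X.det : ℂ) := Complex.normSq_eq_conj_mul_self.symm
    rw [h'] at this
    exact_mod_cast this
  have hd2 : (M + 1) * X = toC (A + D) + Complex.I • toC (B - C) := by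
    rw [Matrix.add_mul, Matrix.one_mul, hYe, hXe, toC_add, toC_sub, smul_sub]
    abel
  have hd3 := normSq_det_linear_part hS
  rw [← hd2, det_mul, map_mul, Complex.normSq_eq_norm_sq] at hd3
  rw [← hd3]
  linear_combination (‖(M + 1).det‖ ^ 2) * hd1

/-! ### Complex Gaussians -/

/-- The Gaussian `exp (-½ x·Mx + b·x)`. -/
def gaussian {n : ℕ} (M : Matrix (Fin n) (Fin n) ℂ) (b : Fin n → ℂ) (x : E n) : ℂ :=
  Complex.exp (-(1 / 2) * (vecC x.ofLp ⬝ᵥ M *ᵥ vecC x.ofLp) + b ⬝ᵥ vecC x.ofLp)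

theorem integral_comp_mulVec {n : ℕ} {K : Matrix (Fin n) (Fin n) ℝ} (hK : K.det ≠ 0)
    {h : (Fin n → ℝ) → ℂ} (hh : Continuous h) :
    ∫ v, h (K *ᵥ v) = ((|K.det|⁻¹ : ℝ) : ℂ) * ∫ u, h u := by
  have hmap := Real.map_matrix_volume_pi_eq_smul_volume_pi hK
  have hc : Continuous (toLin' K) := LinearMap.continuous_of_finiteDimensional _
  have h1 : ∫ v, h (K *ᵥ v) = ∫ u, h u ∂(Measure.map (toLin' K) volume) := by
    rw [integral_map hc.aemeasurable hh.aestronglyMeasurable]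
    simp [toLin'_apply]
  rw [h1, hmap, integral_smul_measure, ENNReal.toReal_ofReal (abs_nonneg _), abs_inv,
    Complex.real_smul]

theorem norm_cpow_half_sq (z : ℂ) : ‖z ^ (1 / 2 : ℂ)‖ ^ 2 = ‖z‖ := by
  rw [← norm_pow]
  congr 1
  simp

theorem one_add_I_mul_ne_zero (d : ℝ) : 1 + Complex.I * (d : ℂ) ≠ 0 := by
  intro h
  have := congrArg Complex.re h
  simp at this

/-- The complex Gaussian integral. -/
theorem integral_gaussian {n : ℕ} {M : Matrix (Fin n) (Fin n) ℂ} (hM : IsSiegel M) :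
    ∃ c : ℂ, ‖c‖ ^ 2 * ‖M.det‖ = (2 * Real.pi) ^ n ∧
      ∀ b, ∫ x, gaussian M b x = c * Complex.exp (1 / 2 * (b ⬝ᵥ M⁻¹ *ᵥ b)) := by
  obtain ⟨K, d, hK, hMK⟩ := hM.exists_diagonal
  set D : Fin n → ℂ := fun i => 1 + Complex.I * (d i : ℂ) with hD
  have hD0 : ∀ i, D i ≠ 0 := fun i => one_add_I_mul_ne_zero (d i)
  have hKu : IsUnit (toC K).det := isUnit_det_toC hK
  have hKu' : IsUnit (toC K)ᵀ.det := by rwa [det_transpose]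
  -- Diagonalization reduces the integral to a product of one-dimensional ones. Only the modulus of
  -- the constant is recorded, so no branch of the square root of `det M` has to be chosen.
  refine ⟨((|K.det|⁻¹ : ℝ) : ℂ) * ∏ i, ((Real.pi : ℂ) / (D i / 2)) ^ (1 / 2 : ℂ), ?_, fun b => ?_⟩
  · rw [hMK, det_mul, det_mul, det_transpose, det_diagonal, det_toC, norm_mul, norm_mul, norm_mul,
      mul_pow, norm_prod, norm_prod, ← Finset.prod_pow]
    simp only [norm_cpow_half_sq]
    have h1 : ∀ i, ‖(Real.pi : ℂ) / (D i / 2)‖ = 2 * Real.pi / ‖D i‖ := by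
      intro i
      simp only [norm_div, Complex.norm_real, Real.norm_eq_abs, abs_of_pos Real.pi_pos,
        RCLike.norm_ofNat]
      field_simp
    have h2 : (∏ i, ‖(Real.pi : ℂ) / (D i / 2)‖) * ∏ i, ‖D i‖ = (2 * Real.pi) ^ n := by
      rw [← Finset.prod_mul_distrib]
      simp only [h1]
      rw [Finset.prod_congr rfl fun i _ => div_mul_cancel₀ _ (norm_ne_zero_iff.mpr (hD0 i))]
      simp
    simp only [Complex.norm_real, Real.norm_eq_abs, abs_inv, abs_abs]
    have hK' : |K.det| ≠ 0 := abs_ne_zero.mpr hK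
    rw [← h2]
    field_simp
  · set c := (toC K)ᵀ⁻¹ *ᵥ b with hc
    have hb : (toC K)ᵀ *ᵥ c = b := by
      rw [hc, mulVec_mulVec, mul_nonsing_inv _ hKu', one_mulVec]
    set h : (Fin n → ℝ) → ℂ := fun u =>
      Complex.exp (-∑ i, D i / 2 * (u i : ℂ) ^ 2 + ∑ i, c i * u i) with hh
    have hgauss : ∀ x : E n, gaussian M b x = h (K *ᵥ x.ofLp) := by
      intro x
      rw [gaussian, hh]
      congr 2
      · rw [hMK, ← mulVec_mulVec, ← mulVec_mulVec, toC_mulVec, dotProduct_mulVec,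
          ← mulVec_transpose, transpose_transpose, toC_mulVec]
        simp only [dotProduct, mulVec_diagonal, vecC_apply, Finset.mul_sum]
        rw [← Finset.sum_neg_distrib]
        exact Finset.sum_congr rfl fun i _ => by ring
      · rw [← hb, mulVec_transpose, ← dotProduct_mulVec, toC_mulVec]
        rfl
    have hcont : Continuous h := by fun_prop
    have h1 : ∫ x, gaussian M b x = ∫ v : Fin n → ℝ, h (K *ᵥ v) := by
      rw [← (EuclideanSpace.volume_preserving_symm_measurableEquiv_toLp (Fin n)).integral_comp
        (MeasurableEquiv.measurableEmbedding _)]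
      exact integral_congr_ae (Filter.Eventually.of_forall hgauss)
    rw [h1, integral_comp_mulVec hK hcont, hh, GaussianFourier.integral_cexp_neg_sum_mul_add
      (fun i => by simp [hD]) c, Finset.prod_mul_distrib, ← Complex.exp_sum, mul_assoc]
    congr 3
    have hMinv : M⁻¹ = (toC K)⁻¹ * diagonal (fun i => (D i)⁻¹) * (toC K)ᵀ⁻¹ := by
      refine inv_eq_left_inv ?_
      rw [hMK]
      simp only [Matrix.mul_assoc]
      rw [← Matrix.mul_assoc (toC K)ᵀ⁻¹, nonsing_inv_mul _ hKu', Matrix.one_mul,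
        ← Matrix.mul_assoc (diagonal _) (diagonal _), diagonal_mul_diagonal]
      simp only [inv_mul_cancel₀ (hD0 _)]
      rw [diagonal_one, Matrix.one_mul, nonsing_inv_mul _ hKu]
    rw [hMinv, ← mulVec_mulVec, ← mulVec_mulVec, ← hc, dotProduct_mulVec, ← mulVec_transpose,
      transpose_nonsing_inv, ← hc]
    simp only [dotProduct, mulVec_diagonal, Finset.mul_sum]
    refine Finset.sum_congr rfl fun i _ => ?_
    have := hD0 i
    field_simp
    ring

/-! ### Gaussians are Schwartz functions. -/

/-- Translating `exp` by `z` multiplies it by the scalar `exp z`, so its derivatives at `z` are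
those at `0` times that scalar. -/
theorem norm_iteratedFDeriv_cexp (i : ℕ) (z : ℂ) :
    ‖iteratedFDeriv ℝ i Complex.exp z‖ = ‖iteratedFDeriv ℝ i Complex.exp 0‖ * Real.exp z.re := by
  have hc : ContDiff ℝ i Complex.exp := Complex.contDiff_exp
  have h1 : (fun w => Complex.exp (z + w)) = Complex.exp z • Complex.exp := by
    ext w; simp [Complex.exp_add]
  have h2 := iteratedFDeriv_comp_add_left (𝕜 := ℝ) (f := Complex.exp) i z 0
  rw [h1, add_zero, iteratedFDeriv_const_smul_apply hc.contDiffAt] at h2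
  rw [← h2, norm_smul, Complex.norm_exp, mul_comm]

/-- The exponential of a function of temperate growth is a Schwartz function if it is rapidly
decreasing. -/
theorem decay_cexp_comp {V : Type*} [NormedAddCommGroup V] [NormedSpace ℝ V] {f : V → ℂ}
    (hf : f.HasTemperateGrowth)
    (hd : ∀ k : ℕ, ∃ C : ℝ, ∀ x, (1 + ‖x‖) ^ k * Real.exp (f x).re ≤ C) (k n : ℕ) :
    ∃ C, ∀ x, ‖x‖ ^ k * ‖iteratedFDeriv ℝ n (fun x => Complex.exp (f x)) x‖ ≤ C := by
  obtain ⟨l, B, hB, hfB⟩ := hf.norm_iteratedFDeriv_le_uniform n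
  obtain ⟨C, hC⟩ := hd (k + l * n)
  set A : ℝ := ∑ i ∈ Finset.range (n + 1), ‖iteratedFDeriv ℝ i Complex.exp 0‖ with hA
  have hA0 : 0 ≤ A := Finset.sum_nonneg fun i _ => norm_nonneg _
  refine ⟨n.factorial * A * (B + 1) ^ n * C, fun x => ?_⟩
  have h1x : 1 ≤ 1 + ‖x‖ := by linarith [norm_nonneg x]
  have key := norm_iteratedFDeriv_comp_le (𝕜 := ℝ) (g := Complex.exp) (f := f) (n := n)
    (N := n) (Complex.contDiff_exp) (hf.1.of_le (mod_cast le_top)) le_rfl x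
    (C := A * Real.exp (f x).re) (D := (B + 1) * (1 + ‖x‖) ^ l) (fun i hi => ?_) (fun i h1 hi => ?_)
  · calc ‖x‖ ^ k * ‖iteratedFDeriv ℝ n (fun x => Complex.exp (f x)) x‖
        ≤ (1 + ‖x‖) ^ k *
          (n.factorial * (A * Real.exp (f x).re) * ((B + 1) * (1 + ‖x‖) ^ l) ^ n) := by
          gcongr
          · linarith
          · exact key
      _ = n.factorial * A * (B + 1) ^ n * ((1 + ‖x‖) ^ (k + l * n) * Real.exp (f x).re) := by
          rw [pow_add, pow_mul, mul_pow]; ring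
      _ ≤ _ := by gcongr; exact hC x
  · rw [norm_iteratedFDeriv_cexp]
    gcongr
    exact Finset.single_le_sum (f := fun i => ‖iteratedFDeriv ℝ i Complex.exp 0‖)
      (fun i _ => norm_nonneg _) (Finset.mem_range.mpr (by omega))
  -- The chain rule estimate asks for a bound by the `i`-th power of `(B + 1)(1 + ‖x‖)^l`. Taking `B
  -- + 1` instead of `B` makes this base at least `1`, so its first power suffices when `i ≥ 1`.
  · have h1 : 1 ≤ (B + 1) * (1 + ‖x‖) ^ l :=
      one_le_mul_of_one_le_of_one_le (by linarith) (one_le_pow₀ h1x)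
    calc ‖iteratedFDeriv ℝ i f x‖ ≤ B * (1 + ‖x‖) ^ l := hfB i hi x
      _ ≤ (B + 1) * (1 + ‖x‖) ^ l := by gcongr; linarith
      _ ≤ _ := le_self_pow₀ h1 (by omega)

theorem pow_mul_exp_quadratic_le {c B : ℝ} (hc : 0 < c) (k : ℕ) :
    ∃ C : ℝ, ∀ r : ℝ, 0 ≤ r → (1 + r) ^ k * Real.exp (-c * r ^ 2 + B * r) ≤ C := by
  -- The polynomial is absorbed by `(1 + r)^k ≤ k! e^(1 + r)`; the rest is the maximum of `(B + 1)r
  -- - cr²`.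
  refine ⟨k.factorial * Real.exp (1 + (B + 1) ^ 2 / (4 * c)), fun r hr => ?_⟩
  have h1 : (1 + r) ^ k ≤ k.factorial * Real.exp (1 + r) := by
    have := Real.pow_div_factorial_le_exp (1 + r) (by linarith) k
    rw [div_le_iff₀ (by positivity)] at this
    linarith
  have h2 : (1 + r) + (-c * r ^ 2 + B * r) ≤ 1 + (B + 1) ^ 2 / (4 * c) := by
    have h3 : (B + 1) ^ 2 / (4 * c) - (B + 1) * r + c * r ^ 2
        = (2 * c * r - (B + 1)) ^ 2 / (4 * c) := by field_simp; ring
    have h4 : 0 ≤ (2 * c * r - (B + 1)) ^ 2 / (4 * c) := by positivity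
    linarith
  calc (1 + r) ^ k * Real.exp (-c * r ^ 2 + B * r)
      ≤ k.factorial * Real.exp (1 + r) * Real.exp (-c * r ^ 2 + B * r) := by gcongr
    _ = k.factorial * Real.exp ((1 + r) + (-c * r ^ 2 + B * r)) := by rw [Real.exp_add (1 + r)]; ring
    _ ≤ _ := by gcongr

theorem norm_sq_eq_dotProduct {n : ℕ} (x : E n) : ‖x‖ ^ 2 = x.ofLp ⬝ᵥ x.ofLp := by
  rw [EuclideanSpace.real_norm_sq_eq]
  simp [dotProduct, sq]

theorem exists_pos_mul_norm_sq_le {n : ℕ} {R : Matrix (Fin n) (Fin n) ℝ} (hR : R.PosDef) :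
    ∃ c : ℝ, 0 < c ∧ ∀ x : E n, c * ‖x‖ ^ 2 ≤ x.ofLp ⬝ᵥ R *ᵥ x.ofLp := by
  obtain ⟨O, hO, hRO⟩ := exists_orthogonal_diagonal hR.isHermitian
  have hμ : ∀ i, 0 < hR.isHermitian.eigenvalues i := hR.eigenvalues_pos
  generalize hR.isHermitian.eigenvalues = μ at hRO hμ
  have hs : 0 ≤ ∑ i, (μ i)⁻¹ := Finset.sum_nonneg fun i _ => (inv_pos.mpr (hμ i)).le
  -- A lower bound for all eigenvalues that avoids a minimum; the summand `1` keeps it positive when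
  -- `n = 0`.
  refine ⟨(∑ i, (μ i)⁻¹ + 1)⁻¹, by positivity, fun x => ?_⟩
  have hle : ∀ i, (∑ i, (μ i)⁻¹ + 1)⁻¹ ≤ μ i := fun i => by
    rw [inv_le_comm₀ (by positivity) (hμ i)]
    have := Finset.single_le_sum (f := fun i => (μ i)⁻¹)
      (fun i _ => (inv_pos.mpr (hμ i)).le) (Finset.mem_univ i)
    linarith
  have h1 : ‖x‖ ^ 2 = (O *ᵥ x.ofLp) ⬝ᵥ (O *ᵥ x.ofLp) := by
    rw [norm_sq_eq_dotProduct, dotProduct_mulVec, ← mulVec_transpose, mulVec_mulVec, hO,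
      one_mulVec]
  have h2 : x.ofLp ⬝ᵥ R *ᵥ x.ofLp = ∑ i, μ i * (O *ᵥ x.ofLp) i ^ 2 := by
    rw [hRO, ← mulVec_mulVec, ← mulVec_mulVec, dotProduct_mulVec, ← mulVec_transpose,
      transpose_transpose]
    simp only [dotProduct, mulVec_diagonal]
    exact Finset.sum_congr rfl fun i _ => by ring
  rw [h1, h2, dotProduct, Finset.mul_sum]
  refine Finset.sum_le_sum fun i _ => ?_
  rw [← sq]
  exact mul_le_mul_of_nonneg_right (hle i) (sq_nonneg _)

theorem hasTemperateGrowth_coord {n : ℕ} (i : Fin n) :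
    (fun x : E n => (x.ofLp i : ℂ)).HasTemperateGrowth :=
  (Complex.ofRealCLM.comp (EuclideanSpace.proj i : E n →L[ℝ] ℝ)).hasTemperateGrowth

theorem hasTemperateGrowth_gaussian_exponent {n : ℕ} (M : Matrix (Fin n) (Fin n) ℂ)
    (b : Fin n → ℂ) : (fun x : E n => -(1 / 2) * (vecC x.ofLp ⬝ᵥ M *ᵥ vecC x.ofLp)
      + b ⬝ᵥ vecC x.ofLp).HasTemperateGrowth := by
  have := hasTemperateGrowth_coord (n := n)
  simp only [dotProduct, mulVec, vecC_apply]
  fun_prop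

/-- Gaussians as Schwartz functions. -/
def gaussianSchwartz {n : ℕ} {M : Matrix (Fin n) (Fin n) ℂ} (hM : IsSiegel M) (b : Fin n → ℂ) :
    𝓢(E n, ℂ) where
  toFun := gaussian M b
  smooth' := by
    have := (hasTemperateGrowth_gaussian_exponent M b).1
    exact Complex.contDiff_exp.comp this
  decay' := by
    refine decay_cexp_comp (hasTemperateGrowth_gaussian_exponent M b) fun k => ?_
    obtain ⟨c, hc, hcR⟩ := exists_pos_mul_norm_sq_le hM.posDef_rePart
    obtain ⟨C, hC⟩ := pow_mul_exp_quadratic_le (c := c / 2) (B := ∑ i, ‖b i‖) (by positivity) k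
    refine ⟨C, fun x => le_trans ?_ (hC ‖x‖ (norm_nonneg x))⟩
    gcongr
    have h1 : (-(1 / 2) * (vecC x.ofLp ⬝ᵥ M *ᵥ vecC x.ofLp)).re
        = -(1 / 2) * (x.ofLp ⬝ᵥ rePart M *ᵥ x.ofLp) := by
      rw [← re_mulVec_vecC, show (-(1 / 2) : ℂ) = ((-(1 / 2) : ℝ) : ℂ) by push_cast; ring,
        Complex.re_ofReal_mul]
    have h2 : (b ⬝ᵥ vecC x.ofLp).re ≤ (∑ i, ‖b i‖) * ‖x‖ := by
      refine (Complex.re_le_norm _).trans ?_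
      rw [dotProduct, Finset.sum_mul]
      refine (norm_sum_le _ _).trans (Finset.sum_le_sum fun i _ => ?_)
      rw [norm_mul, vecC_apply, Complex.norm_real]
      gcongr
      exact PiLp.norm_apply_le x i
    rw [Complex.add_re, h1]
    linarith [hcR x]

@[simp] theorem coe_gaussianSchwartz {n : ℕ} {M : Matrix (Fin n) (Fin n) ℂ} (hM : IsSiegel M)
    (b : Fin n → ℂ) : ⇑(gaussianSchwartz hM b) = gaussian M b := rfl

/-! ### Norms and pairings of Gaussians. -/

theorem conj_gaussian {n : ℕ} (M : Matrix (Fin n) (Fin n) ℂ) (b : Fin n → ℂ) (x : E n) :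
    conj (gaussian M b x) = gaussian (M.map (starRingEnd ℂ)) (star b) x := by
  rw [gaussian, gaussian, ← Complex.exp_conj]
  simp [dotProduct, mulVec, map_ofNat]

theorem gaussian_mul_gaussian {n : ℕ} (M N : Matrix (Fin n) (Fin n) ℂ) (b d : Fin n → ℂ)
    (x : E n) : gaussian M b x * gaussian N d x = gaussian (M + N) (b + d) x := by
  rw [gaussian, gaussian, gaussian, ← Complex.exp_add, add_mulVec, dotProduct_add, add_dotProduct]
  congr 1
  ring

theorem isSiegel_toC {n : ℕ} {R : Matrix (Fin n) (Fin n) ℝ} (hR : R.PosDef) :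
    IsSiegel (toC R) := by
  have hRt : Rᵀ = R := by
    have := hR.isHermitian
    rwa [IsHermitian, conjTranspose_eq_transpose_of_trivial] at this
  have hRt' : (toC R)ᵀ = toC R := by rw [← toC_transpose, hRt]
  refine ⟨hRt', fun y hy => ?_⟩
  have hpq : y = vecC (fun i => (y i).re) + Complex.I • vecC (fun i => (y i).im) := by
    ext i; simp [mul_comm Complex.I, Complex.re_add_im]
  have hre : rePart (toC R) = R := by ext i j; simp [rePart]
  have hp := hR.posSemidef.dotProduct_mulVec_nonneg (fun i => (y i).re)
  have hq := hR.posSemidef.dotProduct_mulVec_nonneg (fun i => (y i).im)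
  rw [star_trivial] at hp hq
  rw [hpq, re_star_dotProduct_mulVec hRt', hre]
  by_cases h0 : (fun i => (y i).re) = 0
  · have h1 : (fun i => (y i).im) ≠ 0 := by
      intro h1
      apply hy
      rw [hpq, h0, h1]
      ext i; simp
    have := hR.dotProduct_mulVec_pos h1
    rw [star_trivial] at this
    linarith
  · have := hR.dotProduct_mulVec_pos h0
    rw [star_trivial] at this
    linarith

/-- The `L²` norm of a Gaussian. -/
theorem norm_gaussian_pow_four {n : ℕ} {M : Matrix (Fin n) (Fin n) ℂ} (hM : IsSiegel M)
    (b : Fin n → ℂ) :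
    ‖(gaussianSchwartz hM b).toLp 2 volume‖ ^ 4 * (2 ^ n * (rePart M).det) = (2 * Real.pi) ^ n *
      Real.exp ((fun i => (b i).re) ⬝ᵥ (rePart M)⁻¹ *ᵥ (fun i => (b i).re)) ^ 2 := by
  set R := rePart M with hR
  set β : Fin n → ℝ := fun i => (b i).re with hβ
  have hRpos : R.PosDef := hM.posDef_rePart
  have hRu : IsUnit R.det := isUnit_iff_ne_zero.mpr hRpos.det_pos.ne'
  have h2R : ((2 : ℝ) • R).PosDef := hRpos.smul two_pos
  have hsum : M + M.map (starRingEnd ℂ) = toC ((2 : ℝ) • R) := by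
    ext i j
    simp only [Matrix.add_apply, map_apply, toC_apply, Matrix.smul_apply, hR, rePart, smul_eq_mul]
    exact Complex.add_conj _
  have hb : b + star b = vecC (2 • β) := by
    ext i
    simp only [Pi.add_apply, Pi.star_apply, vecC_apply, hβ, nsmul_eq_mul]
    exact Complex.add_conj _
  obtain ⟨c, hc, hint⟩ := integral_gaussian (isSiegel_toC h2R)
  have hinv : ((2 : ℝ) • R)⁻¹ = (2 : ℝ)⁻¹ • R⁻¹ := by
    refine inv_eq_left_inv ?_
    rw [Matrix.smul_mul, Matrix.mul_smul, smul_smul, nonsing_inv_mul _ hRu]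
    norm_num
  -- The squared modulus of the Gaussian is the Gaussian with matrix `2R` and linear term `2β`. Its
  -- integral is controlled through `‖c‖ ^ 2`, which is why the statement has a fourth power.
  have hnorm : ((‖(gaussianSchwartz hM b).toLp 2 volume‖ ^ 2 : ℝ) : ℂ)
      = c * Complex.exp ((β ⬝ᵥ R⁻¹ *ᵥ β : ℝ) : ℂ) := by
    have h1 := inner_self_eq_norm_sq_to_K (𝕜 := ℂ) ((gaussianSchwartz hM b).toLp 2 volume)
    rw [SchwartzMap.inner_toL2_toL2_eq _ _ volume] at h1
    have h2 : ∀ x : E n, inner ℂ (gaussianSchwartz hM b x) (gaussianSchwartz hM b x)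
        = gaussian (toC ((2 : ℝ) • R)) (vecC (2 • β)) x := by
      intro x
      rw [RCLike.inner_apply, coe_gaussianSchwartz]
      rw [conj_gaussian, gaussian_mul_gaussian, hsum, hb]
    simp only [h2] at h1
    rw [hint, ← toC_inv h2R.det_pos.ne', toC_mulVec, vecC_dotProduct, hinv] at h1
    push_cast
    refine h1.symm.trans ?_
    congr 2
    rw [smul_mulVec, mulVec_smul, dotProduct_smul, smul_dotProduct, dotProduct_smul]
    simp only [smul_eq_mul, nsmul_eq_mul]
    push_cast
    ring
  have hn := congrArg (fun z => ‖z‖) hnorm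
  simp only [norm_mul, Complex.norm_exp, Complex.ofReal_re, Complex.norm_real] at hn
  rw [Real.norm_of_nonneg (by positivity)] at hn
  rw [det_toC, det_smul, Fintype.card_fin, Complex.norm_real,
    Real.norm_of_nonneg (by have := hRpos.det_pos; positivity)] at hc
  rw [← hc, show ∀ t : ℝ, t ^ 4 = (t ^ 2) ^ 2 from fun t => by ring, hn]
  ring

/-- The pairing of a general Gaussian with a Gaussian of covariance `1`. -/
theorem norm_inner_gaussian_pow_four_le {n : ℕ} {M : Matrix (Fin n) (Fin n) ℂ} (hM : IsSiegel M)
    (b d : Fin n → ℂ) :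
    ‖inner ℂ ((gaussianSchwartz .one d).toLp 2 volume) ((gaussianSchwartz hM b).toLp 2 volume)‖ ^ 4
        * ‖(M + 1).det‖ ^ 2 ≤
      4 ^ n * (rePart M).det * ‖(gaussianSchwartz hM b).toLp 2 volume‖ ^ 4 *
        ‖(gaussianSchwartz (n := n) .one d).toLp 2 volume‖ ^ 4 := by
  obtain ⟨c, hc, hint⟩ := integral_gaussian (hM.add .one)
  have hone : rePart (1 : Matrix (Fin n) (Fin n) ℂ) = 1 := by
    ext i j; by_cases hij : i = j <;> simp [rePart, Matrix.one_apply, hij]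
  have hin : inner ℂ ((gaussianSchwartz .one d).toLp 2 volume)
      ((gaussianSchwartz hM b).toLp 2 volume)
      = c * Complex.exp (1 / 2 * ((b + star d) ⬝ᵥ (M + 1)⁻¹ *ᵥ (b + star d))) := by
    rw [SchwartzMap.inner_toL2_toL2_eq _ _ volume, ← hint]
    refine integral_congr_ae (Filter.Eventually.of_forall fun x => ?_)
    simp only [RCLike.inner_apply, coe_gaussianSchwartz]
    rw [conj_gaussian, gaussian_mul_gaussian]
    simp
  have hexp : ‖Complex.exp (1 / 2 * ((b + star d) ⬝ᵥ (M + 1)⁻¹ *ᵥ (b + star d)))‖ ^ 2 ≤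
      Real.exp ((fun i => (b i).re) ⬝ᵥ (rePart M)⁻¹ *ᵥ (fun i => (b i).re)) *
        Real.exp ((fun i => (d i).re) ⬝ᵥ (fun i => (d i).re)) := by
    rw [Complex.norm_exp, ← Real.exp_nat_mul, ← Real.exp_add, Real.exp_le_exp]
    have := hM.re_dotProduct_inv_le b (star d)
    simp only [Pi.star_apply, RCLike.star_def, Complex.conj_re] at this
    refine le_trans (le_of_eq ?_) this
    rw [show (1 / 2 : ℂ) = ((1 / 2 : ℝ) : ℂ) by push_cast; ring, Complex.re_ofReal_mul]
    push_cast; ring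
  have h1 := norm_gaussian_pow_four hM b
  have h2 := norm_gaussian_pow_four (n := n) .one d
  rw [hone, inv_one, one_mulVec, det_one, mul_one] at h2
  rw [hin, norm_mul]
  set e := ‖Complex.exp (1 / 2 * ((b + star d) ⬝ᵥ (M + 1)⁻¹ *ᵥ (b + star d)))‖
  set e₁ := Real.exp ((fun i => (b i).re) ⬝ᵥ (rePart M)⁻¹ *ᵥ (fun i => (b i).re))
  set e₂ := Real.exp ((fun i => (d i).re) ⬝ᵥ (fun i => (d i).re))
  calc (‖c‖ * e) ^ 4 * ‖(M + 1).det‖ ^ 2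
      = (‖c‖ ^ 2 * ‖(M + 1).det‖) ^ 2 * (e ^ 2) ^ 2 := by ring
    _ ≤ ((2 * Real.pi) ^ n) ^ 2 * (e₁ * e₂) ^ 2 := by rw [hc]; gcongr
    _ = ((2 * Real.pi) ^ n * e₁ ^ 2) * ((2 * Real.pi) ^ n * e₂ ^ 2) := by ring
    _ = _ := by
      rw [← h1, ← h2, show (4 : ℝ) ^ n = 2 ^ n * 2 ^ n by rw [← mul_pow]; norm_num]
      ring

/-! ### Metaplectic operators on Gaussians -/

namespace GeneratingFunction

variable {n : ℕ} (W : GeneratingFunction n)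

/-- The image of a Siegel matrix (shifted by `iQ`) under the free symplectic matrix of `W`. -/
def siegelImage (N : Matrix (Fin n) (Fin n) ℂ) : Matrix (Fin n) (Fin n) ℂ :=
  (toC W.L)ᵀ * N⁻¹ * toC W.L - Complex.I • toC W.P

/-- The linear coefficient of the image of a Gaussian under a quadratic Fourier transform. -/
def linearImage (N : Matrix (Fin n) (Fin n) ℂ) (b : Fin n → ℂ) : Fin n → ℂ :=
  -Complex.I • (((toC W.L)ᵀ * N⁻¹) *ᵥ b)

variable {N : Matrix (Fin n) (Fin n) ℂ}

theorem isSiegel_source (hN : IsSiegel N) : IsSiegel (N + Complex.I • toC W.Q) :=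
  hN.add_I_smul W.Q_symm

theorem isSiegel_siegelImage (hN : IsSiegel N) : IsSiegel (W.siegelImage N) :=
  (hN.inv.congr W.det_L_ne_zero).sub_I_smul W.P_symm

theorem exists_source {M : Matrix (Fin n) (Fin n) ℂ} (hM : IsSiegel M) :
    ∃ N, IsSiegel N ∧ M = N + Complex.I • toC W.Q :=
  ⟨_, hM.sub_I_smul W.Q_symm, (sub_add_cancel _ _).symm⟩

/-- Solving `Lᵀ N⁻¹ L = M + iP` gives `N = L (M + iP)⁻¹ Lᵀ`. Since every Gaussian is thus hit, the
action of the inverse operator on Gaussians can be read off without an integral formula for it. -/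
theorem exists_preimage {M : Matrix (Fin n) (Fin n) ℂ} (hM : IsSiegel M) (b : Fin n → ℂ) :
    ∃ N a, IsSiegel N ∧ M = W.siegelImage N ∧ b = W.linearImage N a := by
  have hT := hM.add_I_smul W.P_symm
  have hLu : IsUnit (toC W.L).det := isUnit_det_toC W.det_L_ne_zero
  have hLu' : IsUnit (toC W.L)ᵀ.det := by rwa [det_transpose]
  have hLt : W.Lᵀ.det ≠ 0 := by rw [det_transpose]; exact W.det_L_ne_zero
  have hN := hT.inv.congr hLt
  rw [toC_transpose, transpose_transpose] at hN
  set N := toC W.L * (M + Complex.I • toC W.P)⁻¹ * (toC W.L)ᵀ with hNdef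
  have hinv : (toC W.L)ᵀ * N⁻¹ * toC W.L = M + Complex.I • toC W.P := by
    rw [hNdef, Matrix.mul_inv_rev, Matrix.mul_inv_rev, nonsing_inv_nonsing_inv _ hT.isUnit_det]
    simp only [Matrix.mul_assoc]
    rw [nonsing_inv_mul _ hLu, Matrix.mul_one, ← Matrix.mul_assoc, mul_nonsing_inv _ hLu',
      Matrix.one_mul]
  refine ⟨N, Complex.I • ((N * (toC W.L)ᵀ⁻¹) *ᵥ b), hN, ?_, ?_⟩
  · rw [siegelImage, hinv, add_sub_cancel_right]
  · rw [linearImage, mulVec_smul, mulVec_mulVec, smul_smul, neg_mul, Complex.I_mul_I, neg_neg,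
      one_smul, Matrix.mul_assoc, ← Matrix.mul_assoc N⁻¹, nonsing_inv_mul _ hN.isUnit_det,
      Matrix.one_mul, mul_nonsing_inv _ hLu', one_mulVec]

/-- The upper block forces the factor `i L⁻¹ N`: the term `L⁻¹Q` cancels against `i L⁻¹ (iQ)`. The
factor is kept explicit because its invertibility is needed for the inverse of `S_W`. -/
theorem freeMatrix_mul_lagrangianFrame (hN : IsSiegel N) :
    toC W.freeMatrix * lagrangianFrame (N + Complex.I • toC W.Q)
      = lagrangianFrame (W.siegelImage N) * (Complex.I • ((toC W.L)⁻¹ * N)) := by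
  have hLu : IsUnit (toC W.L).det := isUnit_det_toC W.det_L_ne_zero
  rw [freeMatrix, toC_fromBlocks, lagrangianFrame, lagrangianFrame, fromBlocks_mul_fromRows,
    fromRows_mul]
  simp only [toC_mul, toC_sub, toC_inv W.det_L_ne_zero, toC_transpose]
  congr 1
  · simp only [Matrix.mul_one, Matrix.one_mul, Matrix.mul_smul, Matrix.mul_add, smul_add,
      smul_smul, Complex.I_mul_I, neg_smul, one_smul, Matrix.mul_neg]
    abel
  · have h1 : (toC W.L)ᵀ * (N⁻¹ * (toC W.L * ((toC W.L)⁻¹ * N))) = (toC W.L)ᵀ := by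
      rw [← Matrix.mul_assoc (toC W.L), mul_nonsing_inv _ hLu, Matrix.one_mul,
        nonsing_inv_mul _ hN.isUnit_det, Matrix.mul_one]
    simp only [siegelImage, smul_sub, Matrix.sub_mul, Matrix.mul_smul, Matrix.smul_mul,
      smul_smul, Complex.I_mul_I, neg_smul, one_smul, Matrix.mul_add, smul_add,
      mul_one, Matrix.mul_assoc, Matrix.mul_neg, Matrix.neg_mul, smul_neg, h1]
    abel

/-- The reason for writing the source matrix as `N + iQ`: the quadratic phase in `x'` cancels, and
the mixed phase `-Lx·x'` only shifts the linear coefficient. -/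
theorem exp_eval_mul_gaussian (b : Fin n → ℂ) (x x' : E n) :
    Complex.exp (Complex.I * (W.eval x x' : ℂ)) * gaussian (N + Complex.I • toC W.Q) b x'
      = Complex.exp (Complex.I / 2 * (vecC x.ofLp ⬝ᵥ toC W.P *ᵥ vecC x.ofLp))
        * gaussian N (b - Complex.I • (toC W.L *ᵥ vecC x.ofLp)) x' := by
  rw [gaussian, gaussian, ← Complex.exp_add, ← Complex.exp_add, eval]
  congr 1
  simp only [Complex.ofReal_add, Complex.ofReal_sub, Complex.ofReal_mul, ← vecC_dotProduct,
    ← toC_mulVec, add_mulVec, smul_mulVec, dotProduct_add, dotProduct_smul, sub_dotProduct,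
    smul_dotProduct, smul_eq_mul]
  rw [dotProduct_comm (toC W.P *ᵥ vecC x.ofLp), dotProduct_comm (toC W.Q *ᵥ vecC x'.ofLp)]
  push_cast
  ring

/-- The Gaussian integral produces `½ (b - iLx)·N⁻¹(b - iLx)`. Its part quadratic in `x`, with the
phase from `P`, is the new matrix, its linear part the new coefficient, and the remainder goes into
`c`. -/
theorem fourierIntegral_gaussian (hN : IsSiegel N) (b : Fin n → ℂ) (m : ℤ) :
    ∃ c : ℂ, ∀ x, W.fourierIntegral m (gaussianSchwartz (W.isSiegel_source hN) b) x
      = c * gaussian (W.siegelImage N) (W.linearImage N b) x := by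
  obtain ⟨c, -, hc⟩ := integral_gaussian hN
  refine ⟨1 / ((((2 * Real.pi) ^ ((n : ℝ) / 2) : ℝ) : ℂ) * Complex.exp (Complex.I * Real.pi * n / 4))
    * (Complex.I ^ m * (Real.sqrt |W.L.det| : ℂ)) *
    (c * Complex.exp (1 / 2 * (b ⬝ᵥ N⁻¹ *ᵥ b))), fun x => ?_⟩
  rw [fourierIntegral]
  simp only [coe_gaussianSchwartz, exp_eval_mul_gaussian]
  rw [integral_const_mul, hc, mul_assoc _ (c * _)]
  congr 1
  rw [gaussian, mul_left_comm, mul_assoc c, ← Complex.exp_add, ← Complex.exp_add]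
  congr 2
  have hNt : (N⁻¹)ᵀ = N⁻¹ := hN.inv.1
  have h1 : (toC W.L *ᵥ vecC x.ofLp) ⬝ᵥ N⁻¹ *ᵥ b
      = b ⬝ᵥ N⁻¹ *ᵥ (toC W.L *ᵥ vecC x.ofLp) := by
    rw [dotProduct_mulVec, ← mulVec_transpose, hNt, dotProduct_comm]
  have h2 : (((toC W.L)ᵀ * N⁻¹) *ᵥ b) ⬝ᵥ vecC x.ofLp
      = b ⬝ᵥ N⁻¹ *ᵥ (toC W.L *ᵥ vecC x.ofLp) := by
    rw [← h1, ← mulVec_mulVec, mulVec_transpose, ← dotProduct_mulVec, dotProduct_comm]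
  have h3 : vecC x.ofLp ⬝ᵥ ((toC W.L)ᵀ * N⁻¹ * toC W.L) *ᵥ vecC x.ofLp
      = (toC W.L *ᵥ vecC x.ofLp) ⬝ᵥ N⁻¹ *ᵥ (toC W.L *ᵥ vecC x.ofLp) := by
    rw [← mulVec_mulVec, ← mulVec_mulVec, dotProduct_mulVec, ← mulVec_transpose,
      transpose_transpose]
  rw [linearImage, siegelImage, smul_dotProduct, h2, sub_mulVec, dotProduct_sub, h3, smul_mulVec,
    dotProduct_smul, mulVec_sub, mulVec_smul, sub_dotProduct, dotProduct_sub, dotProduct_sub,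
    smul_dotProduct, smul_dotProduct, dotProduct_smul, dotProduct_smul, h1]
  simp only [smul_eq_mul]
  linear_combination (1 / 2 * ((toC W.L *ᵥ vecC x.ofLp) ⬝ᵥ N⁻¹ *ᵥ (toC W.L *ᵥ vecC x.ofLp)))
    * Complex.I_mul_I

end GeneratingFunction

theorem toLp_gaussian_ne_zero {n : ℕ} {M : Matrix (Fin n) (Fin n) ℂ} (hM : IsSiegel M)
    (b : Fin n → ℂ) : (gaussianSchwartz hM b).toLp 2 volume ≠ 0 := by
  intro h0
  have h := norm_gaussian_pow_four hM b
  rw [h0, norm_zero, zero_pow (by norm_num), zero_mul] at h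
  have : 0 < (2 * Real.pi) ^ n *
      Real.exp ((fun i => (b i).re) ⬝ᵥ (rePart M)⁻¹ *ᵥ (fun i => (b i).re)) ^ 2 := by positivity
  exact this.ne h

theorem GeneratingFunction.IsQuadraticFourierTransform.apply_gaussian {n : ℕ}
    {W : GeneratingFunction n} {m : ℤ} {U : L2 n ≃ₗᵢ[ℂ] L2 n}
    (hU : W.IsQuadraticFourierTransform m U) {N : Matrix (Fin n) (Fin n) ℂ} (hN : IsSiegel N)
    (b : Fin n → ℂ) :
    ∃ c : ℂ, c ≠ 0 ∧ U ((gaussianSchwartz (W.isSiegel_source hN) b).toLp 2 volume)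
      = c • (gaussianSchwartz (W.isSiegel_siegelImage hN) (W.linearImage N b)).toLp 2 volume := by
  obtain ⟨c, hc⟩ := W.fourierIntegral_gaussian hN b m
  have heq : U ((gaussianSchwartz (W.isSiegel_source hN) b).toLp 2 volume)
      = c • (gaussianSchwartz (W.isSiegel_siegelImage hN) (W.linearImage N b)).toLp 2 volume := by
    refine Lp.ext ?_
    filter_upwards [hU.2 (gaussianSchwartz (W.isSiegel_source hN) b), Lp.coeFn_smul c
      ((gaussianSchwartz (W.isSiegel_siegelImage hN) (W.linearImage N b)).toLp 2 volume),
      (gaussianSchwartz (W.isSiegel_siegelImage hN) (W.linearImage N b)).coeFn_toLp 2 volume]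
      with x h1 h2 h3
    rw [h1, h2, hc, Pi.smul_apply, h3, smul_eq_mul, coe_gaussianSchwartz]
  refine ⟨c, fun h0 => ?_, heq⟩
  rw [h0, zero_smul] at heq
  exact toLp_gaussian_ne_zero (W.isSiegel_source hN) b (U.map_eq_zero_iff.mp heq)

/-! ### The action of the whole metaplectic group on Gaussians. -/

/-- `U` maps Gaussians to multiples of Gaussians, acting on their covariances through `S`. -/
def TransformsGaussians {n : ℕ} (U : L2 n ≃ₗᵢ[ℂ] L2 n) (S : Sp n) : Prop :=
  ∀ (M : Matrix (Fin n) (Fin n) ℂ) (hM : IsSiegel M) (b : Fin n → ℂ),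
    ∃ (M' : Matrix (Fin n) (Fin n) ℂ) (hM' : IsSiegel M') (b' : Fin n → ℂ) (c : ℂ),
      SiegelRel (S : Matrix (Fin n ⊕ Fin n) (Fin n ⊕ Fin n) ℝ) M M' ∧
      U ((gaussianSchwartz hM b).toLp 2 volume) = c • (gaussianSchwartz hM' b').toLp 2 volume

theorem TransformsGaussians.mul {n : ℕ} {U V : L2 n ≃ₗᵢ[ℂ] L2 n} {S T : Sp n}
    (hU : TransformsGaussians U S) (hV : TransformsGaussians V T) :
    TransformsGaussians (U * V) (S * T) := by
  intro M hM b
  obtain ⟨M', hM', b', c, hrel, hc⟩ := hV M hM b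
  obtain ⟨M'', hM'', b'', c', hrel', hc'⟩ := hU M' hM' b'
  refine ⟨M'', hM'', b'', c * c', hrel.trans hrel', ?_⟩
  change U (V _) = _
  rw [hc, map_smul, hc', smul_smul]

theorem GeneratingFunction.IsQuadraticFourierTransform.transformsGaussians {n : ℕ}
    {W : GeneratingFunction n} {m : ℤ} {U : L2 n ≃ₗᵢ[ℂ] L2 n}
    (hU : W.IsQuadraticFourierTransform m U) : TransformsGaussians U W.freeSymplectic := by
  intro M hM b
  obtain ⟨N, hN, rfl⟩ := W.exists_source hM
  obtain ⟨c, -, hc⟩ := hU.apply_gaussian hN b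
  exact ⟨_, W.isSiegel_siegelImage hN, _, c, ⟨_, W.freeMatrix_mul_lagrangianFrame hN⟩, hc⟩

theorem GeneratingFunction.IsQuadraticFourierTransform.transformsGaussians_inv {n : ℕ}
    {W : GeneratingFunction n} {m : ℤ} {U : L2 n ≃ₗᵢ[ℂ] L2 n}
    (hU : W.IsQuadraticFourierTransform m U) : TransformsGaussians U⁻¹ W.freeSymplectic⁻¹ := by
  intro M hM b
  obtain ⟨N, a, hN, rfl, rfl⟩ := W.exists_preimage hM b
  obtain ⟨c, hc0, hc⟩ := hU.apply_gaussian hN a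
  refine ⟨_, W.isSiegel_source hN, a, c⁻¹, ?_, ?_⟩
  · have hX : IsUnit (Complex.I • ((toC W.L)⁻¹ * N)).det := by
      rw [det_smul, det_mul]
      exact ((isUnit_iff_ne_zero.mpr Complex.I_ne_zero).pow _).mul
        ((isUnit_nonsing_inv_det _ (isUnit_det_toC W.det_L_ne_zero)).mul hN.isUnit_det)
    have hS : toC (W.freeSymplectic⁻¹ : Sp n).1 * toC W.freeMatrix = 1 := by
      rw [← toC_mul, ← toC_one]
      exact congrArg (fun T : Sp n => toC T.1) (inv_mul_cancel W.freeSymplectic)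
    refine ⟨(Complex.I • ((toC W.L)⁻¹ * N))⁻¹, ?_⟩
    have h1 := congrArg (fun Y => toC (W.freeSymplectic⁻¹ : Sp n).1 * Y *
      (Complex.I • ((toC W.L)⁻¹ * N))⁻¹) (W.freeMatrix_mul_lagrangianFrame hN)
    rw [← Matrix.mul_assoc (toC _), hS, Matrix.one_mul, Matrix.mul_assoc (toC _),
      Matrix.mul_assoc (lagrangianFrame _), mul_nonsing_inv _ hX, Matrix.mul_one] at h1
    exact h1.symm
  · change U.symm _ = _
    rw [LinearIsometryEquiv.symm_apply_eq, map_smul, hc, smul_smul, inv_mul_cancel₀ hc0, one_smul]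

/-- Induction over the generated subgroup of pairs. The property is not visibly stable under
inversion, so it is carried for the pair and its inverse together. -/
theorem IsProjection.transformsGaussians {n : ℕ} {U : L2 n ≃ₗᵢ[ℂ] L2 n} {S : Sp n}
    (h : IsProjection U S) : TransformsGaussians U S := by
  have key : ∀ p ∈ projectionGraph n,
      TransformsGaussians p.1 p.2 ∧ TransformsGaussians p.1⁻¹ p.2⁻¹ := by
    intro p hp
    refine Subgroup.closure_induction (p := fun p _ => TransformsGaussians p.1 p.2 ∧
      TransformsGaussians p.1⁻¹ p.2⁻¹) ?_ ?_ ?_ ?_ hp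
    · rintro ⟨U, S⟩ ⟨W, m, hW, rfl⟩
      exact ⟨hW.transformsGaussians, hW.transformsGaussians_inv⟩
    · have : TransformsGaussians (1 : L2 n ≃ₗᵢ[ℂ] L2 n) (1 : Sp n) := fun M hM b =>
        ⟨M, hM, b, 1, SiegelRel.refl M, by rw [one_smul]; rfl⟩
      simpa using this
    · rintro p q - - ⟨hp, hp'⟩ ⟨hq, hq'⟩
      refine ⟨hp.mul hq, ?_⟩
      rw [Prod.fst_mul, Prod.snd_mul, _root_.mul_inv_rev, _root_.mul_inv_rev]
      exact hq'.mul hp'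
    · rintro p - ⟨hp, hp'⟩
      exact ⟨hp', by simpa using hp⟩
  exact (key _ h).1

/-- The dispersive estimate for Gaussian wave packets. -/
theorem IsProjection.norm_inner_gaussian_le {n : ℕ} {U : L2 n ≃ₗᵢ[ℂ] L2 n} {S : Sp n}
    (h : IsProjection U S) (b d : Fin n → ℂ) :
    ‖inner ℂ ((gaussianSchwartz .one d).toLp 2 volume)
        (U ((gaussianSchwartz .one b).toLp 2 volume))‖ ^ 4
        * (1 + (S : Matrix (Fin n ⊕ Fin n) (Fin n ⊕ Fin n) ℝ)ᵀ * S.1).det ≤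
      4 ^ n * ‖(gaussianSchwartz (n := n) .one b).toLp 2 volume‖ ^ 4 *
        ‖(gaussianSchwartz (n := n) .one d).toLp 2 volume‖ ^ 4 := by
  obtain ⟨M, hM, b', c, hrel, hc⟩ := h.transformsGaussians 1 .one b
  have h1 := hrel.det_rePart_mul hM
  have h2 := norm_inner_gaussian_pow_four_le hM b' d
  -- Unitarity eliminates the unknown factor `c`: it enters both sides of the estimate as `‖c‖ ^ 4`.
  have hnorm : ‖(gaussianSchwartz (n := n) .one b).toLp 2 volume‖
      = ‖c‖ * ‖(gaussianSchwartz hM b').toLp 2 volume‖ := by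
    rw [← norm_smul, ← hc, U.norm_map]
  have hpos := hM.posDef_rePart.det_pos
  rw [hc, inner_smul_right, norm_mul, hnorm]
  rw [← h1] at h2
  set Δ := (1 + (S : Matrix (Fin n ⊕ Fin n) (Fin n ⊕ Fin n) ℝ)ᵀ * S.1).det
  refine le_of_mul_le_mul_left ?_ hpos
  calc (rePart M).det * ((‖c‖ * _) ^ 4 * Δ) = ‖c‖ ^ 4 * (_ ^ 4 * ((rePart M).det * Δ)) := by ring
    _ ≤ ‖c‖ ^ 4 * _ := mul_le_mul_of_nonneg_left h2 (by positivity)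
    _ = _ := by ring

/-! ### Singular values -/

theorem det_one_add_eq_prod {V : Type*} [NormedAddCommGroup V] [InnerProductSpace ℝ V]
    [FiniteDimensional ℝ V] {A : V →ₗ[ℝ] V} (hA : A.IsSymmetric) {m : ℕ}
    (hm : Module.finrank ℝ V = m) :
    LinearMap.det (1 + A) = ∏ i, (1 + hA.eigenvalues hm i) := by
  rw [← LinearMap.det_toMatrix (hA.eigenvectorBasis hm).toBasis]
  have : LinearMap.toMatrix (hA.eigenvectorBasis hm).toBasis (hA.eigenvectorBasis hm).toBasis
      (1 + A) = diagonal (fun i => 1 + hA.eigenvalues hm i) := by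
    ext i j
    rw [LinearMap.toMatrix_apply, OrthonormalBasis.coe_toBasis, LinearMap.add_apply,
      hA.apply_eigenvectorBasis, Module.End.one_apply]
    by_cases hij : i = j
    · subst hij; simp
    · simp [hij]
  rw [this, det_diagonal]

theorem det_one_add_transpose_mul_self {n : ℕ} (S : Sp n) :
    (1 + (S : Matrix (Fin n ⊕ Fin n) (Fin n ⊕ Fin n) ℝ)ᵀ * S.1).det
      = ∏ i : Fin (n + n), (1 + singularValue S i ^ 2) := by
  set T := Matrix.toEuclideanLin (S : Matrix (Fin n ⊕ Fin n) (Fin n ⊕ Fin n) ℝ) with hT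
  have hfin : Module.finrank ℝ (EuclideanSpace ℝ (Fin n ⊕ Fin n)) = n + n := by simp
  have hA := T.isPositive_adjoint_comp_self.isSymmetric
  have h1 : Matrix.toEuclideanLin
      (1 + (S : Matrix (Fin n ⊕ Fin n) (Fin n ⊕ Fin n) ℝ)ᵀ * S.1)
      = 1 + T.adjoint ∘ₗ T := by
    rw [hT, ← Matrix.toEuclideanLin_conjTranspose_eq_adjoint,
      conjTranspose_eq_transpose_of_trivial]
    ext x i
    simp [Matrix.toLpLin_apply, mulVec_mulVec]
  have h2 : (1 + (S : Matrix (Fin n ⊕ Fin n) (Fin n ⊕ Fin n) ℝ)ᵀ * S.1).det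
      = LinearMap.det (1 + T.adjoint ∘ₗ T) := by
    rw [← h1, LinearMap.det_toLpLin]
  rw [h2, det_one_add_eq_prod hA hfin]
  refine Finset.prod_congr rfl fun i _ => ?_
  rw [singularValue, LinearMap.sq_singularValues_fin _ hfin]

theorem singularValue_pos {n : ℕ} (S : Sp n) {i : ℕ} (hi : i < n) : 0 < singularValue S i := by
  have hinj : Function.Injective
      (Matrix.toEuclideanLin (S : Matrix (Fin n ⊕ Fin n) (Fin n ⊕ Fin n) ℝ)) := by
    have hu := SymplecticGroup.symplectic_det S.2
    refine (injective_iff_map_eq_zero _).mpr fun x hx => ?_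
    have h0 : S.1 *ᵥ x.ofLp = 0 := congrArg WithLp.ofLp hx
    have h1 : x.ofLp = 0 := by
      rw [← one_mulVec x.ofLp, ← nonsing_inv_mul _ hu, ← mulVec_mulVec, h0, mulVec_zero]
    ext i; exact congrFun h1 i
  rw [singularValue]
  refine (LinearMap.injective_iff_forall_lt_finrank_singularValues_pos _).mp hinj i ?_
  simp only [finrank_euclideanSpace, Fintype.card_sum, Fintype.card_fin]
  omega

theorem prod_singularValue_pos {n : ℕ} (S : Sp n) :
    0 < ∏ i ∈ Finset.range n, singularValue S i :=
  Finset.prod_pos fun _ hi => singularValue_pos S (Finset.mem_range.mp hi)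

/-- In the product of all `1 + σᵢ²` the term `σᵢ²` is kept for the first `n` indices and the term
`1` for the last `n`. -/
theorem prod_singularValue_sq_le {n : ℕ} (S : Sp n) :
    (∏ i ∈ Finset.range n, singularValue S i) ^ 2
      ≤ (1 + (S : Matrix (Fin n ⊕ Fin n) (Fin n ⊕ Fin n) ℝ)ᵀ * S.1).det := by
  rw [det_one_add_transpose_mul_self, Fin.prod_univ_add, ← Finset.prod_pow,
    ← Fin.prod_univ_eq_prod_range (fun i => singularValue S i ^ 2)]
  have h1 : ∏ i : Fin n, singularValue S i ^ 2
      ≤ ∏ i : Fin n, (1 + singularValue S (Fin.castAdd n i) ^ 2) :=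
    Finset.prod_le_prod (fun i _ => sq_nonneg _) fun i _ => by simp
  have h2 : 1 ≤ ∏ i : Fin n, (1 + singularValue S (Fin.natAdd n i) ^ 2) := by
    have := Finset.prod_le_prod (s := Finset.univ) (f := fun _ : Fin n => (1 : ℝ))
      (g := fun i => 1 + singularValue S (Fin.natAdd n i) ^ 2) (fun i _ => zero_le_one)
      fun i _ => le_add_of_nonneg_right (sq_nonneg _)
    simpa using this
  exact h1.trans (le_mul_of_one_le_right (Finset.prod_nonneg fun i _ => by positivity) h2)

/-- The dispersive estimate for Gaussian wave packets, in terms of singular values. -/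
theorem IsProjection.norm_inner_gaussian_le_prod {n : ℕ} {U : L2 n ≃ₗᵢ[ℂ] L2 n} {S : Sp n}
    (h : IsProjection U S) (b d : Fin n → ℂ) :
    ‖inner ℂ ((gaussianSchwartz .one d).toLp 2 volume)
        (U ((gaussianSchwartz .one b).toLp 2 volume))‖ ≤
      2 ^ n * (∏ i ∈ Finset.range n, singularValue S i) ^ (-(1 / 2) : ℝ) *
        ‖(gaussianSchwartz (n := n) .one b).toLp 2 volume‖ *
        ‖(gaussianSchwartz (n := n) .one d).toLp 2 volume‖ := by
  have h1 := h.norm_inner_gaussian_le b d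
  have h2 := prod_singularValue_sq_le S
  have hp := prod_singularValue_pos S
  set p := ∏ i ∈ Finset.range n, singularValue S i
  set Δ := (1 + (S : Matrix (Fin n ⊕ Fin n) (Fin n ⊕ Fin n) ℝ)ᵀ * S.1).det
  refine le_of_pow_le_pow_left₀ (n := 4) (by norm_num) (by positivity) ?_
  have h3 : (p ^ (-(1 / 2) : ℝ)) ^ 4 = (p ^ 2)⁻¹ := by
    rw [← Real.rpow_natCast, ← Real.rpow_mul hp.le, ← Real.rpow_natCast, ← Real.rpow_neg hp.le]
    norm_num
  rw [mul_pow, mul_pow, mul_pow, h3]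
  -- The fourth root of `4 ^ n` is weakened to `2 ^ n` to stay with natural powers.
  have h4 : (4 : ℝ) ^ n ≤ (2 ^ n) ^ 4 := by
    rw [← pow_mul, mul_comm, pow_mul]
    exact pow_le_pow_left₀ (by norm_num) (by norm_num) n
  set a := ‖inner ℂ ((gaussianSchwartz .one d).toLp 2 volume)
        (U ((gaussianSchwartz .one b).toLp 2 volume))‖
  calc a ^ 4 = a ^ 4 * p ^ 2 * (p ^ 2)⁻¹ := by field_simp
    _ ≤ a ^ 4 * Δ * (p ^ 2)⁻¹ := by gcongr
    _ ≤ _ := (mul_le_mul_of_nonneg_right h1 (by positivity))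
    _ ≤ (2 ^ n) ^ 4 * ‖(gaussianSchwartz (n := n) .one b).toLp 2 volume‖ ^ 4 *
        ‖(gaussianSchwartz (n := n) .one d).toLp 2 volume‖ ^ 4 * (p ^ 2)⁻¹ := by gcongr
    _ = _ := by ring

/-! ### The short-time Fourier transform -/

section STFT

open scoped FourierTransform Convolution

variable {n : ℕ}

/-- The product of `f` with the complex conjugate of the translate by `x` of the window `φ`. -/
def windowed (f φ : 𝓢(E n, ℂ)) (x : E n) : 𝓢(E n, ℂ) :=
  SchwartzMap.pairing (ContinuousLinearMap.mul ℂ ℂ) f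
    (SchwartzMap.compSubConstCLM ℝ x
      (SchwartzMap.postcompCLM (Complex.conjCLE : ℂ →L[ℝ] ℂ) φ))

@[simp] theorem windowed_apply (f φ : 𝓢(E n, ℂ)) (x y : E n) :
    windowed f φ x y = f y * conj (φ (y - x)) := by
  simp [windowed, SchwartzMap.pairing_apply_apply]

/-- The Fourier transform `𝓕` has kernel `e^(-2πi y·η)`, hence the rescaled frequency; this is the
source of the factors `(2π)^n` below. -/
theorem integral_mul_conj_timeFrequencyShift (k : E n → ℂ) (φ : E n → ℂ) (x ξ : E n) :
    ∫ y, k y * conj (timeFrequencyShift φ (x, ξ) y)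
      = 𝓕 (fun y => k y * conj (φ (y - x))) ((2 * Real.pi)⁻¹ • ξ) := by
  rw [Real.fourier_eq']
  refine integral_congr_ae (Filter.Eventually.of_forall fun y => ?_)
  simp only [timeFrequencyShift, map_mul, ← Complex.exp_conj, Complex.conj_I, Complex.conj_ofReal,
    smul_eq_mul, real_inner_smul_right, real_inner_comm y ξ]
  rw [mul_left_comm]
  congr 2
  have : (Real.pi : ℂ) ≠ 0 := by exact_mod_cast Real.pi_ne_zero
  push_cast
  field_simp

/-- Parseval with `K` merely integrable: the transform is moved from `K` onto `𝓕 F`, and inversion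
is needed only for the Schwartz function `F`. -/
theorem integral_fourier_mul_conj_fourier (F : 𝓢(E n, ℂ)) {K : E n → ℂ} (hK : Integrable K) :
    ∫ η, 𝓕 (F : E n → ℂ) η * conj (𝓕 K η) = ∫ y, F y * conj (K y) := by
  have h := VectorFourier.integral_sesq_fourierIntegral_eq_neg_flip (innerSL ℂ (E := ℂ))
    (L := innerₗ (E n)) Real.continuous_fourierChar continuous_inner hK
    ((𝓕 F : 𝓢(E n, ℂ)).integrable (μ := volume))
  have h2 : ∀ y, VectorFourier.fourierIntegral Real.fourierChar volume (-(innerₗ (E n)).flip)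
      ((𝓕 F : 𝓢(E n, ℂ)) : E n → ℂ) y = F y := by
    intro y
    have h3 : 𝓕⁻ (𝓕 F) = F := FourierTransform.fourierInv_fourier_eq F
    have h4 : (𝓕⁻ (𝓕 F) : 𝓢(E n, ℂ)) y = 𝓕⁻ ((𝓕 F : 𝓢(E n, ℂ)) : E n → ℂ) y := by
      rw [SchwartzMap.fourierInv_coe]
    rw [h3] at h4
    rw [h4, flip_innerₗ]
    rfl
  simp only [h2] at h
  exact h

/-- Parseval in the frequency variable at fixed position `x`. The product of the square integrable
`k` with a translated window is integrable, which is all Parseval asks of it. -/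
theorem integral_stft_mul_conj_stft (f φ γ : 𝓢(E n, ℂ)) {k : E n → ℂ} (hk : MemLp k 2)
    (x : E n) :
    ∫ ξ, (∫ y, f y * conj (timeFrequencyShift φ (x, ξ) y)) *
        conj (∫ y, k y * conj (timeFrequencyShift γ (x, ξ) y))
      = ((2 * Real.pi) ^ n : ℝ) * ∫ y, (f y * conj (k y)) * (conj (φ (y - x)) * γ (y - x)) := by
  have hγ : MemLp (fun y => conj (γ (y - x))) 2 := by
    have := (SchwartzMap.compSubConstCLM ℝ x
      (SchwartzMap.postcompCLM (Complex.conjCLE : ℂ →L[ℝ] ℂ) γ)).memLp 2 volume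
    refine this.congr_norm ?_ ?_
    · exact (Complex.continuous_conj.comp (γ.continuous.comp
        (continuous_id.sub continuous_const))).aestronglyMeasurable
    · exact Filter.Eventually.of_forall fun y => by simp
  have hK : Integrable (fun y => k y * conj (γ (y - x))) := hk.integrable_mul hγ
  have hF : (windowed f φ x : E n → ℂ) = fun y => f y * conj (φ (y - x)) := by
    ext y; simp
  simp only [integral_mul_conj_timeFrequencyShift]
  rw [Measure.integral_comp_inv_smul volume
    (fun η => 𝓕 (fun y => f y * conj (φ (y - x))) η * conj (𝓕 (fun y => k y * conj (γ (y - x))) η)),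
    ← hF, integral_fourier_mul_conj_fourier _ hK, finrank_euclideanSpace, Fintype.card_fin,
    abs_of_pos (by positivity), Complex.real_smul]
  congr 2
  ext y
  simp only [windowed_apply, map_mul, Complex.conj_conj]
  ring

theorem aestronglyMeasurable_stft (f φ : 𝓢(E n, ℂ)) :
    AEStronglyMeasurable
      (fun z : E n × E n => ∫ y : E n, f y * conj (timeFrequencyShift φ z y)) := by
  have hc : Continuous (fun p : (E n × E n) × E n =>
      f p.2 * conj (timeFrequencyShift φ p.1 p.2)) := by
    unfold timeFrequencyShift
    have := f.continuous
    have := φ.continuous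
    fun_prop
  exact hc.stronglyMeasurable.integral_prod_right'.aestronglyMeasurable

/-- The pairing of a Schwartz function `f` with `k` is controlled by the pairings of `k` with the
time-frequency shifts of `γ`, through the resolution of the identity with windows `φ` and `γ`. -/
theorem enorm_integral_mul_conj_le (f φ γ : 𝓢(E n, ℂ)) {k : E n → ℂ} (hk : MemLp k 2)
    {B : ℝ≥0∞} (hB : ∀ z, ‖∫ y, k y * conj (timeFrequencyShift γ z y)‖ₑ ≤ B) :
    ENNReal.ofReal ((2 * Real.pi) ^ n) * ‖∫ y, f y * conj (k y)‖ₑ * ‖∫ y, γ y * conj (φ y)‖ₑ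
      ≤ B * modulationNorm φ 1 f := by
  set A : E n → ℂ := fun y => f y * conj (k y) with hA
  set D : E n → ℂ := fun t => conj (φ (-t)) * γ (-t) with hD
  have hkc : MemLp (fun y => conj (k y)) 2 := hk.star
  have hAi : Integrable A := (f.memLp 2 volume).integrable_mul hkc
  have hDi' : Integrable (fun t => conj (φ t) * γ t) :=
    (φ.memLp 2 volume).star.integrable_mul (γ.memLp 2 volume)
  have hDi : Integrable D := hDi'.comp_neg
  have hDint : ∫ t, D t = ∫ y, γ y * conj (φ y) := by
    rw [hD, integral_neg_eq_self (fun t => conj (φ t) * γ t)]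
    simp only [mul_comm]
  -- As a function of `x`, the Parseval identity is a convolution, so integrating over `x` factors
  -- into `⟨f,k⟩⟨γ,φ⟩`. Integrability over phase space of the product of the two transforms is not
  -- required.
  have hconv : ∫ x, (A ⋆[ContinuousLinearMap.mul ℂ ℂ, volume] D) x
      = (∫ y, A y) * ∫ t, D t :=
    integral_convolution (ContinuousLinearMap.mul ℂ ℂ) hAi hDi
  have hAD : ∀ x, (A ⋆[ContinuousLinearMap.mul ℂ ℂ, volume] D) x
      = ∫ y, (f y * conj (k y)) * (conj (φ (y - x)) * γ (y - x)) := by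
    intro x
    simp [convolution, hA, hD]
  have hpi : ENNReal.ofReal ((2 * Real.pi) ^ n) = ‖(((2 * Real.pi) ^ n : ℝ) : ℂ)‖ₑ := by
    rw [← ofReal_norm, Complex.norm_real, Real.norm_of_nonneg (by positivity)]
  calc ENNReal.ofReal ((2 * Real.pi) ^ n) * ‖∫ y, A y‖ₑ * ‖∫ y, γ y * conj (φ y)‖ₑ
      = ‖∫ x, (((2 * Real.pi) ^ n : ℝ) : ℂ) *
          (A ⋆[ContinuousLinearMap.mul ℂ ℂ, volume] D) x‖ₑ := by
        rw [integral_const_mul, hconv, hDint, hpi, enorm_mul, enorm_mul, mul_assoc]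
    _ ≤ ∫⁻ x, ‖(((2 * Real.pi) ^ n : ℝ) : ℂ) *
          (A ⋆[ContinuousLinearMap.mul ℂ ℂ, volume] D) x‖ₑ := enorm_integral_le_lintegral_enorm _
    _ ≤ ∫⁻ x, ∫⁻ ξ, B * ‖∫ y, f y * conj (timeFrequencyShift φ (x, ξ) y)‖ₑ := by
        refine lintegral_mono fun x => ?_
        rw [hAD, ← integral_stft_mul_conj_stft f φ γ hk x]
        refine (enorm_integral_le_lintegral_enorm _).trans (lintegral_mono fun ξ => ?_)
        rw [enorm_mul, mul_comm, RCLike.enorm_conj]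
        gcongr
        exact hB _
    _ = B * modulationNorm φ 1 f := by
        rw [modulationNorm, eLpNorm_one_eq_lintegral_enorm,
          ← lintegral_const_mul'' _ (aestronglyMeasurable_stft f φ).enorm, Measure.volume_eq_prod,
          lintegral_prod _ ((aestronglyMeasurable_stft f φ).enorm.const_mul _)]

/-! ### Schwartz functions have integrable short-time Fourier transforms. -/

/-- Since `1 + ‖x‖ ≤ (1 + ‖y‖)(1 + ‖y - x‖)`, any power of `1 + ‖x‖` can be shared between the decay
of `f` at `y` and that of the window at `y - x`. -/
theorem exists_seminorm_windowed_le (f φ : 𝓢(E n, ℂ)) (m k l : ℕ) :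
    ∃ C : ℝ, 0 ≤ C ∧ ∀ x, (1 + ‖x‖) ^ m * SchwartzMap.seminorm ℝ k l (windowed f φ x) ≤ C := by
  set ψ := SchwartzMap.postcompCLM (Complex.conjCLE : ℂ →L[ℝ] ℂ) φ
  set C₁ := 2 ^ (k + m) * (Finset.Iic (k + m, l)).sup (fun p => SchwartzMap.seminorm ℝ p.1 p.2) f
  set C₂ := 2 ^ m * (Finset.Iic (m, l)).sup (fun p => SchwartzMap.seminorm ℝ p.1 p.2) ψ
  have h₁ : ∀ i ≤ l, ∀ y, (1 + ‖y‖) ^ (k + m) * ‖iteratedFDeriv ℝ i f y‖ ≤ C₁ := fun i hi y =>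
    SchwartzMap.one_add_le_sup_seminorm_apply (𝕜 := ℝ) (m := (k + m, l)) le_rfl hi f y
  have h₂ : ∀ i ≤ l, ∀ y, (1 + ‖y‖) ^ m * ‖iteratedFDeriv ℝ i ψ y‖ ≤ C₂ := fun i hi y =>
    SchwartzMap.one_add_le_sup_seminorm_apply (𝕜 := ℝ) (m := (m, l)) le_rfl hi ψ y
  have hC₁ : 0 ≤ C₁ := le_trans (by positivity) (h₁ 0 (Nat.zero_le _) 0)
  have hC₂ : 0 ≤ C₂ := le_trans (by positivity) (h₂ 0 (Nat.zero_le _) 0)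
  set C := ∑ i ∈ Finset.range (l + 1), (l.choose i : ℝ) * C₁ * C₂
  have hC : 0 ≤ C := Finset.sum_nonneg fun i _ => by positivity
  refine ⟨C, hC, fun x => ?_⟩
  have hx : 0 < (1 + ‖x‖) ^ m := by positivity
  rw [← le_div_iff₀' hx]
  refine SchwartzMap.seminorm_le_bound ℝ k l _ (by positivity) fun y => ?_
  rw [le_div_iff₀' hx]
  have hmul : (windowed f φ x : E n → ℂ) = fun y => f y * ψ (y - x) := by
    ext y; simp [ψ]
  have hD := norm_iteratedFDeriv_mul_le (𝕜 := ℝ) (N := l) (f := f) (g := fun y => ψ (y - x))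
    (f.smooth l) ((ψ.smooth l).comp (contDiff_id.sub contDiff_const)) y (n := l) le_rfl
  rw [hmul]
  have hy : 1 + ‖x‖ ≤ (1 + ‖y‖) * (1 + ‖y - x‖) := by
    have h3 : ‖x‖ ≤ ‖y‖ + ‖y - x‖ := by
      have := norm_sub_le y (y - x)
      simpa using this
    nlinarith [norm_nonneg y, norm_nonneg (y - x), mul_nonneg (norm_nonneg y) (norm_nonneg (y - x))]
  calc (1 + ‖x‖) ^ m * (‖y‖ ^ k * ‖iteratedFDeriv ℝ l (fun y => f y * ψ (y - x)) y‖)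
      ≤ ((1 + ‖y‖) * (1 + ‖y - x‖)) ^ m * ((1 + ‖y‖) ^ k * ∑ i ∈ Finset.range (l + 1),
          (l.choose i : ℝ) * ‖iteratedFDeriv ℝ i f y‖ *
            ‖iteratedFDeriv ℝ (l - i) (fun y => ψ (y - x)) y‖) := by
        gcongr
        linarith
    _ = ∑ i ∈ Finset.range (l + 1), (l.choose i : ℝ) *
          ((1 + ‖y‖) ^ (k + m) * ‖iteratedFDeriv ℝ i f y‖) *
          ((1 + ‖y - x‖) ^ m * ‖iteratedFDeriv ℝ (l - i) ψ (y - x)‖) := by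
        rw [Finset.mul_sum, Finset.mul_sum]
        refine Finset.sum_congr rfl fun i _ => ?_
        rw [iteratedFDeriv_comp_sub, mul_pow, pow_add]
        ring
    _ ≤ C := by
        refine Finset.sum_le_sum fun i hi => ?_
        have hi' : i ≤ l := by have := Finset.mem_range.mp hi; omega
        have := h₁ i hi' y
        have := h₂ (l - i) (by omega) (y - x)
        gcongr

/-- Continuity of the Fourier transform on Schwartz space bounds the decay in `η` by finitely many
seminorms of `windowed f φ x`, which themselves decay in `x`. -/
theorem exists_fourier_windowed_le (f φ : 𝓢(E n, ℂ)) (m : ℕ) :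
    ∃ C : ℝ, 0 ≤ C ∧ ∀ x η, (1 + ‖x‖) ^ m * ((1 + ‖η‖) ^ m * ‖𝓕 (windowed f φ x) η‖) ≤ C := by
  set q : Seminorm ℝ 𝓢(E n, ℂ) :=
    (Finset.Iic (m, 0)).sup fun p => SchwartzMap.seminorm ℝ p.1 p.2 with hq
  have hcont : Continuous (q.comp
      (SchwartzMap.fourierTransformCLM ℝ : 𝓢(E n, ℂ) →L[ℝ] 𝓢(E n, ℂ)).toLinearMap) := by
    have h1 : Continuous q := Seminorm.continuous_finsetSup fun p _ =>
      (schwartz_withSeminorms ℝ (E n) ℂ).continuous_seminorm p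
    exact h1.comp (SchwartzMap.fourierTransformCLM ℝ).continuous
  obtain ⟨s, C, -, hle⟩ := Seminorm.bound_of_continuous (schwartz_withSeminorms ℝ (E n) ℂ) _ hcont
  choose D hD0 hD using fun p : ℕ × ℕ => exists_seminorm_windowed_le f φ m p.1 p.2
  refine ⟨2 ^ m * (C * ∑ p ∈ s, D p), by
    have := Finset.sum_nonneg fun p (_ : p ∈ s) => hD0 p
    positivity, fun x η => ?_⟩
  have h1 : (1 + ‖η‖) ^ m * ‖𝓕 (windowed f φ x) η‖ ≤ 2 ^ m * q (𝓕 (windowed f φ x)) := by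
    have := SchwartzMap.one_add_le_sup_seminorm_apply (𝕜 := ℝ) (m := (m, 0)) le_rfl le_rfl
      (𝓕 (windowed f φ x)) η
    rwa [norm_iteratedFDeriv_zero] at this
  have h2 : q (𝓕 (windowed f φ x))
      ≤ C * (s.sup (schwartzSeminormFamily ℝ (E n) ℂ)) (windowed f φ x) := hle (windowed f φ x)
  have h3 : (s.sup (schwartzSeminormFamily ℝ (E n) ℂ)) (windowed f φ x)
      ≤ (∑ p ∈ s, D p) / (1 + ‖x‖) ^ m := by
    refine Seminorm.finset_sup_apply_le (by
      have := Finset.sum_nonneg fun p (_ : p ∈ s) => hD0 p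
      positivity) fun p hp => ?_
    rw [le_div_iff₀' (by positivity)]
    exact (hD p x).trans (Finset.single_le_sum (fun p _ => hD0 p) hp)
  calc (1 + ‖x‖) ^ m * ((1 + ‖η‖) ^ m * ‖𝓕 (windowed f φ x) η‖)
      ≤ (1 + ‖x‖) ^ m * (2 ^ m * (C * ((∑ p ∈ s, D p) / (1 + ‖x‖) ^ m))) := by
        refine mul_le_mul_of_nonneg_left (h1.trans ?_) (by positivity)
        refine mul_le_mul_of_nonneg_left (h2.trans ?_) (by positivity)
        exact mul_le_mul_of_nonneg_left h3 C.2
    _ = _ := by field_simp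

/-- Schwartz functions belong to `M¹`. -/
theorem modulationNorm_one_lt_top (φ f : 𝓢(E n, ℂ)) : modulationNorm φ 1 f < ∞ := by
  -- Order `n + 1` in each of the two `n`-dimensional variables is enough for integrability.
  obtain ⟨C, hC0, hC⟩ := exists_fourier_windowed_le f φ (n + 1)
  have hint : Integrable (fun x : E n => (1 + ‖x‖) ^ (-((n : ℝ) + 1))) :=
    integrable_one_add_norm (by simp)
  have hprod := (hint.mul_prod hint).const_mul (C * (2 * Real.pi) ^ (n + 1))
  rw [← Measure.volume_eq_prod] at hprod
  have hI : Integrable (fun z : E n × E n => ∫ y : E n, f y * conj (timeFrequencyShift φ z y)) := by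
    refine hprod.mono' (aestronglyMeasurable_stft f φ) (Filter.Eventually.of_forall ?_)
    rintro ⟨x, ξ⟩
    have hF : (windowed f φ x : E n → ℂ) = fun y => f y * conj (φ (y - x)) := by
      ext y; simp
    rw [integral_mul_conj_timeFrequencyShift, ← hF, ← SchwartzMap.fourier_coe]
    set η := (2 * Real.pi)⁻¹ • ξ with hη
    have hpi : 1 ≤ 2 * Real.pi := by linarith [Real.pi_gt_three]
    have h1 : 1 + ‖ξ‖ ≤ 2 * Real.pi * (1 + ‖η‖) := by
      have : ‖ξ‖ = 2 * Real.pi * ‖η‖ := by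
        rw [hη, norm_smul, Real.norm_of_nonneg (by positivity), mul_inv_cancel_left₀ (by positivity)]
      rw [this]
      linarith
    have h2 : ∀ t : E n, (1 + ‖t‖) ^ (-((n : ℝ) + 1)) = ((1 + ‖t‖) ^ (n + 1))⁻¹ := fun t => by
      rw [Real.rpow_neg (by positivity), ← Real.rpow_natCast]
      push_cast; rfl
    simp only [h2]
    rw [← mul_inv, ← div_eq_mul_inv, le_div_iff₀ (by positivity)]
    calc ‖𝓕 (windowed f φ x) η‖ * ((1 + ‖x‖) ^ (n + 1) * (1 + ‖ξ‖) ^ (n + 1))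
        ≤ ‖𝓕 (windowed f φ x) η‖ *
          ((1 + ‖x‖) ^ (n + 1) * (2 * Real.pi * (1 + ‖η‖)) ^ (n + 1)) := by gcongr
      _ = (1 + ‖x‖) ^ (n + 1) * ((1 + ‖η‖) ^ (n + 1) * ‖𝓕 (windowed f φ x) η‖)
          * (2 * Real.pi) ^ (n + 1) := by rw [mul_pow]; ring
      _ ≤ C * (2 * Real.pi) ^ (n + 1) := by gcongr; exact hC x η
  exact memLp_one_iff_integrable.mpr hI |>.2

end STFT

section Dispersive

variable {n : ℕ}

/-! ### Gaussian wave packets -/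

/-- Shifting only changes the complex linear coefficient, up to a scalar. A bound uniform in that
coefficient therefore covers all wave packets. -/
theorem timeFrequencyShift_gaussian (b : Fin n → ℂ) (z : E n × E n) (y : E n) :
    timeFrequencyShift (gaussian 1 b) z y =
      Complex.exp (-(1 / 2) * (vecC z.1.ofLp ⬝ᵥ vecC z.1.ofLp) - b ⬝ᵥ vecC z.1.ofLp) *
        gaussian 1 (b + vecC z.1.ofLp + Complex.I • vecC z.2.ofLp) y := by
  have h1 : ((inner ℝ z.2 y : ℝ) : ℂ) = vecC z.2.ofLp ⬝ᵥ vecC y.ofLp := by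
    rw [EuclideanSpace.inner_eq_star_dotProduct, star_trivial, vecC_dotProduct, dotProduct_comm]
  have h2 : vecC (y - z.1).ofLp = vecC y.ofLp - vecC z.1.ofLp := by
    ext i; simp
  rw [timeFrequencyShift, gaussian, gaussian, ← Complex.exp_add, ← Complex.exp_add, h1, h2]
  congr 1
  simp only [one_mulVec, dotProduct_sub, sub_dotProduct, add_dotProduct, smul_dotProduct,
    smul_eq_mul]
  rw [dotProduct_comm (vecC y.ofLp) (vecC z.1.ofLp)]
  ring

theorem norm_gaussian_one (b : Fin n → ℂ) :
    ‖(gaussianSchwartz .one b).toLp 2 volume‖ = ‖(gaussianSchwartz (n := n) .one 0).toLp 2 volume‖ *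
      Real.exp (((fun i => (b i).re) ⬝ᵥ fun i => (b i).re) / 2) := by
  have hone : rePart (1 : Matrix (Fin n) (Fin n) ℂ) = 1 := by
    ext i j; by_cases hij : i = j <;> simp [rePart, Matrix.one_apply, hij]
  have h1 := norm_gaussian_pow_four (n := n) .one b
  have h2 := norm_gaussian_pow_four (n := n) .one 0
  have h0 : (fun _ : Fin n => (0 : ℝ)) = 0 := rfl
  rw [hone, inv_one, one_mulVec, det_one, mul_one] at h1 h2
  simp only [Pi.zero_apply, Complex.zero_re, h0, dotProduct_zero, Real.exp_zero, one_pow,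
    mul_one] at h2
  set t := (fun i => (b i).re) ⬝ᵥ fun i => (b i).re
  refine (pow_left_inj₀ (norm_nonneg _) (by positivity) (show 4 ≠ 0 by norm_num)).mp ?_
  have h3 : Real.exp (t / 2) ^ 4 = Real.exp t ^ 2 := by
    rw [← Real.exp_nat_mul, ← Real.exp_nat_mul]; congr 1; push_cast; ring
  have h4 : (2 : ℝ) ^ n ≠ 0 := by positivity
  rw [mul_pow, h3]
  refine mul_right_cancel₀ h4 ?_
  rw [h1, ← h2]
  ring

/-- Time-frequency shifts preserve the `L²` norm of a Gaussian. -/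
theorem norm_exp_mul_norm_gaussian (b : Fin n → ℂ) (z : E n × E n) :
    ‖Complex.exp (-(1 / 2) * (vecC z.1.ofLp ⬝ᵥ vecC z.1.ofLp) - b ⬝ᵥ vecC z.1.ofLp)‖ *
      ‖(gaussianSchwartz .one (b + vecC z.1.ofLp + Complex.I • vecC z.2.ofLp)).toLp 2 volume‖
      = ‖(gaussianSchwartz .one b).toLp 2 volume‖ := by
  rw [norm_gaussian_one, norm_gaussian_one b, mul_left_comm, Complex.norm_exp, ← Real.exp_add]
  congr 2
  have h1 : (fun i => ((b + vecC z.1.ofLp + Complex.I • vecC z.2.ofLp) i).re)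
      = (fun i => (b i).re) + z.1.ofLp := by
    ext i; simp
  have h2 : (b ⬝ᵥ vecC z.1.ofLp).re = z.1.ofLp ⬝ᵥ fun i => (b i).re := by
    rw [dotProduct_comm, re_vecC_dotProduct]
  rw [h1, Complex.sub_re, h2, vecC_dotProduct,
    show (-(1 / 2) : ℂ) = ((-(1 / 2) : ℝ) : ℂ) by push_cast; ring, ← Complex.ofReal_mul,
    Complex.ofReal_re, add_dotProduct, dotProduct_add, dotProduct_add,
    dotProduct_comm (fun i => (b i).re) z.1.ofLp]
  ring

theorem integral_mul_conj_eq_inner (u : L2 n) (f : 𝓢(E n, ℂ)) :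
    ∫ y, u y * conj (f y) = inner ℂ (f.toLp 2 volume) u := by
  rw [L2.inner_def]
  refine integral_congr_ae ?_
  filter_upwards [f.coeFn_toLp 2 volume] with y hy
  rw [RCLike.inner_apply, hy]

theorem integral_mul_conj_timeFrequencyShift_gaussian (u : L2 n) (b : Fin n → ℂ)
    (z : E n × E n) :
    ∫ y, u y * conj (timeFrequencyShift (gaussian 1 b) z y) =
      conj (Complex.exp (-(1 / 2) * (vecC z.1.ofLp ⬝ᵥ vecC z.1.ofLp) - b ⬝ᵥ vecC z.1.ofLp)) *
        inner ℂ ((gaussianSchwartz .one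
          (b + vecC z.1.ofLp + Complex.I • vecC z.2.ofLp)).toLp 2 volume) u := by
  rw [← integral_mul_conj_eq_inner, ← integral_const_mul]
  refine integral_congr_ae (Filter.Eventually.of_forall fun y => ?_)
  simp only [timeFrequencyShift_gaussian, map_mul, coe_gaussianSchwartz]
  ring

theorem IsProjection.norm_stft_gaussian_le {U : L2 n ≃ₗᵢ[ℂ] L2 n} {S : Sp n}
    (h : IsProjection U S) (b d : Fin n → ℂ) (z : E n × E n) :
    ‖∫ y, U ((gaussianSchwartz .one b).toLp 2 volume) y *
        conj (timeFrequencyShift (gaussian 1 d) z y)‖ ≤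
      2 ^ n * (∏ i ∈ Finset.range n, singularValue S i) ^ (-(1 / 2) : ℝ) *
        ‖(gaussianSchwartz (n := n) .one b).toLp 2 volume‖ *
        ‖(gaussianSchwartz (n := n) .one d).toLp 2 volume‖ := by
  rw [integral_mul_conj_timeFrequencyShift_gaussian, norm_mul, RCLike.norm_conj]
  refine (mul_le_mul_of_nonneg_left (h.norm_inner_gaussian_le_prod b _) (norm_nonneg _)).trans ?_
  rw [mul_left_comm, norm_exp_mul_norm_gaussian]

/-- Undoing a time-frequency shift in the first argument of a pairing. -/
theorem integral_shift_mul_conj (u φ : E n → ℂ) (w z : E n × E n) :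
    ‖∫ y, (u (y + w.1) * Complex.exp (-(Complex.I * ((inner ℝ w.2 (y + w.1) : ℝ) : ℂ)))) *
        conj (timeFrequencyShift φ z y)‖
      = ‖∫ y, u y * conj (timeFrequencyShift φ (z + w) y)‖ := by
  rw [← integral_sub_right_eq_self (fun y => (u (y + w.1) *
    Complex.exp (-(Complex.I * ((inner ℝ w.2 (y + w.1) : ℝ) : ℂ)))) *
        conj (timeFrequencyShift φ z y)) w.1]
  have h : ∀ y, (u (y - w.1 + w.1) *
      Complex.exp (-(Complex.I * ((inner ℝ w.2 (y - w.1 + w.1) : ℝ) : ℂ)))) *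
        conj (timeFrequencyShift φ z (y - w.1))
      = Complex.exp (Complex.I * ((inner ℝ z.2 w.1 : ℝ) : ℂ)) *
        (u y * conj (timeFrequencyShift φ (z + w) y)) := by
    intro y
    simp only [timeFrequencyShift, sub_add_cancel, Prod.snd_add, Prod.fst_add, map_mul,
      ← Complex.exp_conj, Complex.conj_I, Complex.conj_ofReal, inner_add_left, inner_sub_right]
    rw [show y - w.1 - z.1 = y - (z.1 + w.1) by abel]
    have : Complex.exp (-(Complex.I * ((inner ℝ w.2 y : ℝ) : ℂ))) *
        Complex.exp (-Complex.I * ((inner ℝ z.2 y - inner ℝ z.2 w.1 : ℝ) : ℂ))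
        = Complex.exp (Complex.I * ((inner ℝ z.2 w.1 : ℝ) : ℂ)) *
          Complex.exp (-Complex.I * ((inner ℝ z.2 y + inner ℝ w.2 y : ℝ) : ℂ)) := by
      rw [← Complex.exp_add, ← Complex.exp_add]
      congr 1
      push_cast
      ring
    linear_combination (u y * conj (φ (y - (z.1 + w.1)))) * this
  simp only [h]
  rw [integral_const_mul, norm_mul, mul_comm Complex.I, Complex.norm_exp_ofReal_mul_I, one_mul]

theorem memLp_shift {u : E n → ℂ} (hu : MemLp u 2) (w : E n × E n) :
    MemLp (fun y => u (y + w.1) *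
      Complex.exp (-(Complex.I * ((inner ℝ w.2 (y + w.1) : ℝ) : ℂ)))) 2 := by
  have h1 : MemLp (fun y => u (y + w.1)) 2 :=
    hu.comp_measurePreserving (measurePreserving_add_right volume w.1)
  refine h1.congr_norm (h1.1.mul ?_) (Filter.Eventually.of_forall fun y => ?_)
  · exact (by fun_prop : Continuous fun y : E n =>
      Complex.exp (-(Complex.I * ((inner ℝ w.2 (y + w.1) : ℝ) : ℂ)))).aestronglyMeasurable
  · rw [norm_mul, ← mul_neg, mul_comm Complex.I, ← Complex.ofReal_neg,
      Complex.norm_exp_ofReal_mul_I, mul_one]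

theorem norm_integral_mul_conj_self (b : Fin n → ℂ) :
    ‖∫ y, gaussian 1 b y * conj (gaussian 1 b y)‖
      = ‖(gaussianSchwartz (n := n) .one b).toLp 2 volume‖ ^ 2 := by
  have h := inner_self_eq_norm_sq_to_K (𝕜 := ℂ) ((gaussianSchwartz (n := n) .one b).toLp 2 volume)
  rw [SchwartzMap.inner_toL2_toL2_eq _ _ volume] at h
  have h2 := congrArg norm h
  simp only [RCLike.inner_apply, coe_gaussianSchwartz] at h2
  rw [h2]
  simp

/-! ### Replacing the Gaussian analysis window by `φ`. -/

/-- Uniform dispersive bound for a general Schwartz analysis window. -/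
theorem exists_norm_stft_le (φ : 𝓢(E n, ℂ)) :
    ∃ κ : ℝ, 0 ≤ κ ∧ ∀ (U : L2 n ≃ₗᵢ[ℂ] L2 n) (S : Sp n), IsProjection U S →
      ∀ (b : Fin n → ℂ) (w : E n × E n),
        ‖∫ y, U ((gaussianSchwartz .one b).toLp 2 volume) y *
            conj (timeFrequencyShift φ w y)‖ ≤
          κ * (∏ i ∈ Finset.range n, singularValue S i) ^ (-(1 / 2) : ℝ) *
            ‖(gaussianSchwartz (n := n) .one b).toLp 2 volume‖ := by
  set g : 𝓢(E n, ℂ) := gaussianSchwartz .one 0 with hg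
  set N := ‖g.toLp 2 volume‖ with hN
  have hNpos : 0 < N := norm_pos_iff.mpr (toLp_gaussian_ne_zero .one 0)
  have hfin := modulationNorm_one_lt_top g φ
  set A : ℝ := (2 * Real.pi) ^ n with hA
  have hApos : 0 < A := by positivity
  -- The resolution of the identity has `⟨g,g⟩ = N²` on the left and one factor `N` in its bound
  -- `B`, which leaves `A * N` in the denominator.
  refine ⟨2 ^ n * (modulationNorm g 1 φ).toReal / (A * N), by positivity,
    fun U S h b w => ?_⟩
  set P := (∏ i ∈ Finset.range n, singularValue S i) ^ (-(1 / 2) : ℝ)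
  have hP : 0 ≤ P := Real.rpow_nonneg (prod_singularValue_pos S).le _
  set u := U ((gaussianSchwartz .one b).toLp 2 volume)
  set Nb := ‖(gaussianSchwartz (n := n) .one b).toLp 2 volume‖
  -- Here `φ` is the function being expanded. The shift by `w` is undone on the other factor instead
  -- of being put on `φ`, so the norm of `φ` that appears does not depend on `w`.
  have key := enorm_integral_mul_conj_le φ g g (memLp_shift (Lp.memLp u) w)
    (B := ENNReal.ofReal (2 ^ n * P * Nb * N)) (fun z => by
      rw [← ofReal_norm, integral_shift_mul_conj]
      exact ENNReal.ofReal_le_ofReal (h.norm_stft_gaussian_le b 0 (z + w)))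
  have h1 : ‖∫ y, φ y * conj (u (y + w.1) *
      Complex.exp (-(Complex.I * ((inner ℝ w.2 (y + w.1) : ℝ) : ℂ))))‖
      = ‖∫ y, u y * conj (timeFrequencyShift φ w y)‖ := by
    have h2 := integral_shift_mul_conj u φ w 0
    rw [zero_add] at h2
    rw [← h2, ← RCLike.norm_conj, ← integral_conj]
    congr 2
    ext y
    simp [timeFrequencyShift, mul_comm]
  have h3 := ENNReal.toReal_mono (ENNReal.mul_ne_top ENNReal.ofReal_ne_top hfin.ne) key
  rw [ENNReal.toReal_mul, ENNReal.toReal_mul, ENNReal.toReal_mul, toReal_enorm, toReal_enorm, h1,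
    ENNReal.toReal_ofReal hApos.le, ENNReal.toReal_ofReal (by positivity), hg,
    coe_gaussianSchwartz, norm_integral_mul_conj_self, ← hg, ← hN] at h3
  rw [div_mul_eq_mul_div, div_mul_eq_mul_div, le_div_iff₀ (by positivity)]
  refine le_of_mul_le_mul_right ?_ hNpos
  linarith

/-- A fixed Gaussian may be orthogonal to `φ`. But for `b = -2πiη` these integrals are the Fourier
transform of `exp (-|y|²/2)` times the conjugate of `φ`, and the Gaussian factor has no zeros. -/
theorem exists_integral_gaussian_mul_conj_ne_zero {φ : 𝓢(E n, ℂ)} (hφ : φ ≠ 0) :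
    ∃ b : Fin n → ℂ, ∫ y, gaussian 1 b y * conj (φ y) ≠ 0 := by
  by_contra! hzero
  apply hφ
  have hF : FourierTransform.fourier (windowed (gaussianSchwartz .one 0) φ 0) = 0 := by
    ext η
    have h1 := integral_mul_conj_timeFrequencyShift (gaussian (n := n) 1 0) φ 0
      ((2 * Real.pi) • η)
    rw [inv_smul_smul₀ (by positivity)] at h1
    have h2 : (windowed (gaussianSchwartz .one 0) φ 0 : E n → ℂ)
        = fun y => gaussian 1 0 y * conj (φ (y - 0)) := by
      ext y; simp
    rw [SchwartzMap.fourier_coe, h2, ← h1]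
    refine Eq.trans ?_ (hzero (-Complex.I • vecC ((2 * Real.pi) • η).ofLp))
    congr 1
    ext y
    have h3 : ((inner ℝ ((2 * Real.pi) • η) y : ℝ) : ℂ)
        = vecC ((2 * Real.pi) • η).ofLp ⬝ᵥ vecC y.ofLp := by
      rw [EuclideanSpace.inner_eq_star_dotProduct, star_trivial, vecC_dotProduct, dotProduct_comm]
    simp only [timeFrequencyShift, map_mul, ← Complex.exp_conj, Complex.conj_I,
      Complex.conj_ofReal, sub_zero]
    rw [h3, gaussian, gaussian, ← mul_assoc, ← Complex.exp_add]
    congr 2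
    simp [smul_dotProduct]
  have hw : windowed (gaussianSchwartz .one 0) φ 0 = 0 := by
    have := congrArg FourierTransformInv.fourierInv hF
    rwa [FourierTransform.fourierInv_fourier_eq, FourierTransform.fourierInv_zero] at this
  ext y
  have hy := DFunLike.congr_fun hw y
  rw [windowed_apply, coe_gaussianSchwartz, sub_zero] at hy
  have := (mul_eq_zero.mp hy).resolve_left (Complex.exp_ne_zero _)
  simpa using this

theorem memLp_timeFrequencyShift (φ : 𝓢(E n, ℂ)) (w : E n × E n) :
    MemLp (timeFrequencyShift φ w) 2 := by
  refine ((SchwartzMap.compSubConstCLM ℝ w.1 φ).memLp 2 volume).congr_norm ?_ ?_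
  · have := φ.continuous
    refine Continuous.aestronglyMeasurable ?_
    unfold timeFrequencyShift
    fun_prop
  · refine Filter.Eventually.of_forall fun y => ?_
    rw [timeFrequencyShift, norm_mul, mul_comm Complex.I, Complex.norm_exp_ofReal_mul_I, one_mul,
      SchwartzMap.compSubConstCLM_apply]

theorem inner_toLp_timeFrequencyShift (φ : 𝓢(E n, ℂ)) (w : E n × E n) (u : L2 n) :
    inner ℂ ((memLp_timeFrequencyShift φ w).toLp _) u
      = ∫ y, u y * conj (timeFrequencyShift φ w y) := by
  rw [L2.inner_def]
  refine integral_congr_ae ?_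
  filter_upwards [(memLp_timeFrequencyShift φ w).coeFn_toLp] with y hy
  rw [RCLike.inner_apply, hy]

end Dispersive

end Metaplectic

end

/-! ### The dispersive estimate for general functions and windows. -/

theorem theorem1p1 (n : ℕ) (φ : 𝓢(Metaplectic.E n, ℂ)) (hφ : φ ≠ 0) :
    ∃ C : ℝ, 0 < C ∧
      ∀ Shat ∈ Metaplectic.Mp n, ∀ S : Metaplectic.Sp n, Metaplectic.IsProjection Shat S →
        ∀ ψ : 𝓢(Metaplectic.E n, ℂ),
          Metaplectic.modulationNorm φ ∞ (Shat (ψ.toLp 2 volume)) ≤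
            ENNReal.ofReal
              (C * (∏ i ∈ Finset.range n, Metaplectic.singularValue S i) ^ (-(1 / 2) : ℝ)) *
              Metaplectic.modulationNorm φ 1 ψ := by
  obtain ⟨κ, hκ, hbound⟩ := Metaplectic.exists_norm_stft_le φ
  obtain ⟨b, hb⟩ := Metaplectic.exists_integral_gaussian_mul_conj_ne_zero hφ
  set γ : 𝓢(Metaplectic.E n, ℂ) := Metaplectic.gaussianSchwartz .one b with hγ
  set c := ‖∫ y, γ y * conj (φ y)‖ with hc
  have hcpos : 0 < c := norm_pos_iff.mpr hb
  set A : ℝ := (2 * Real.pi) ^ n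
  have hA : 0 < A := by positivity
  set N := ‖γ.toLp 2 volume‖
  -- The summand `1` only ensures positivity, since `κ` is merely nonnegative.
  refine ⟨κ * N / (A * c) + 1, by positivity, fun U _ S hS ψ => ?_⟩
  set P := (∏ i ∈ Finset.range n, Metaplectic.singularValue S i) ^ (-(1 / 2) : ℝ)
  have hP : 0 ≤ P := Real.rpow_nonneg (Metaplectic.prod_singularValue_pos S).le _
  rw [Metaplectic.modulationNorm, eLpNorm_exponent_top]
  refine eLpNormEssSup_le_of_ae_enorm_bound (Filter.Eventually.of_forall fun w => ?_)
  -- Duality takes `U` off `ψ`: `⟨Uψ, φ_w⟩ = ⟨ψ, k⟩`, while `⟨k, γ_z⟩ = ⟨φ_w, Uγ_z⟩` involves `U`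
  -- only on Gaussians, where `hbound` applies.
  set k : Metaplectic.L2 n := U.symm ((Metaplectic.memLp_timeFrequencyShift φ w).toLp _) with hk
  have hkey := Metaplectic.enorm_integral_mul_conj_le ψ φ γ (Lp.memLp k)
    (B := ENNReal.ofReal (κ * P * N)) (fun z => by
      rw [← ofReal_norm]
      refine ENNReal.ofReal_le_ofReal ?_
      rw [hγ, Metaplectic.coe_gaussianSchwartz,
        Metaplectic.integral_mul_conj_timeFrequencyShift_gaussian, norm_mul, RCLike.norm_conj,
        ← U.inner_map_map, hk, U.apply_symm_apply, norm_inner_symm,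
        Metaplectic.inner_toLp_timeFrequencyShift]
      refine (mul_le_mul_of_nonneg_left (hbound U S hS _ w) (norm_nonneg _)).trans ?_
      rw [mul_left_comm, Metaplectic.norm_exp_mul_norm_gaussian])
  have h1 : ‖∫ y, ψ y * conj (k y)‖ₑ
      = ‖∫ y, U (ψ.toLp 2 volume) y * conj (Metaplectic.timeFrequencyShift φ w y)‖ₑ := by
    rw [← Metaplectic.inner_toLp_timeFrequencyShift, ← U.apply_symm_apply
      ((Metaplectic.memLp_timeFrequencyShift φ w).toLp _), U.inner_map_map, ← hk, L2.inner_def]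
    congr 1
    refine integral_congr_ae ?_
    filter_upwards [ψ.coeFn_toLp 2 volume] with y hy
    rw [RCLike.inner_apply, hy]
  rw [h1, ← ofReal_norm (∫ y, γ y * conj (φ y)), ← hc, mul_right_comm,
    ← ENNReal.ofReal_mul hA.le] at hkey
  set X := ‖∫ y, U (ψ.toLp 2 volume) y * conj (Metaplectic.timeFrequencyShift φ w y)‖ₑ
  have hAc : 0 < A * c := by positivity
  calc X ≤ ENNReal.ofReal (κ * P * N) * Metaplectic.modulationNorm φ 1 ψ
        / ENNReal.ofReal (A * c) := by
        rw [ENNReal.le_div_iff_mul_le (Or.inl (by simpa using hAc)) (Or.inl ENNReal.ofReal_ne_top),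
          mul_comm]
        exact hkey
    _ = ENNReal.ofReal (κ * P * N / (A * c)) * Metaplectic.modulationNorm φ 1 ψ := by
        rw [ENNReal.ofReal_div_of_pos hAc, ENNReal.mul_div_right_comm]
    _ ≤ _ := by
        gcongr
        have : κ * P * N / (A * c) = κ * N / (A * c) * P := by ring
        rw [this]
        gcongr
        linarith
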